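/- **Notation.** Write $a=(a_0,a_1,a_2;a_3,a_4)$, $s(a)=a_3+a_4-a_0-a_1-a_2$, $\mathbf 1=(1,1,1;1,1)$, let $e_0,\dots,e_4$ be the standard basis of $\mathbb Z^5$, and $$f(a)=\sum_{k\ge 0}\frac{\Gamma(a_0+k)\Gamma(a_1+k)\Gamma(a_2+k)}{\Gamma(1+k)\Gamma(a_3+k)\Gamma(a_4+k)} .$$ The six companions of $f$ are $y^{(0)}_i(a)=f(\sigma^{(0)}_i(a))$ and $y^{(\infty)}_i(a)=e^{\mathrm i\pi s(a)}f(\sigma^{(\infty)}_i(a))$, $i=0,1,2$, where $\sigma_0^{(0)}(a)=a$, $\sigma_1^{(0)}(a)=(a_0+1-a_3,a_1+1-a_3,a_2+1-a_3;\,2-a_3,a_4+1-a_3)$, $\sigma_2^{(0)}(a)=(a_0+1-a_4,a_1+1-a_4,a_2+1-a_4;\,a_3+1-a_4,2-a_4)$, $\sigma_0^{(\infty)}(a)=(a_0,a_0+1-a_3,a_0+1-a_4;\,a_0+1-a_1,a_0+1-a_2)$, $\sigma_1^{(\infty)}(a)=(a_1+1-a_3,a_1,a_1+1-a_4;\,a_1+1-a_0,a_1+1-a_2)$,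 $\sigma_2^{(\infty)}(a)=(a_2+1-a_4,a_2+1-a_3,a_2;\,a_2+1-a_1,a_2+1-a_0)$. They are considered for generic $a\in\mathbb C^5$ (all $a_i\notin\mathbb Z$, and all $a_i-a_j\notin\mathbb Z$ for $i\ne j$) with $\operatorname{Re}s(a)>0$, where all six series converge. A relation among $h(a)$, $h(a+p)$, $h(a+q)$ (or two of them) is an identity of functions on the set of generic $a$ at which all the terms that occur converge and all coefficients are regular. Let $\varphi_1,\varphi_2,\varphi_3$ be the elementary symmetric polynomials in $a_0,a_1,a_2$. The contiguous matrices over $\mathbb Q(a)$ are, for $\{i,j,k\}=\{0,1,2\}$, $$A_i^+(a)=\begin{pmatrix}a_i&1\\ \frac{\varphi_3}{s(a)-2}&\frac{a_ja_k-(a_i-a_3+1)(a_i-a_4+1)}{s(a)-2}\end{pmatrix},$$ for $i=3,4$, with $d_i=(a_i-a_0)(a_i-a_1)(a_i-a_2)$, $$A_i^+(a)=\frac1{d_i}\begin{pmatrix}a_i^2-\varphi_1a_i+\varphi_2&-(s(a)-1)\\-\varphi_3&a_i(s(a)-1)\end{pmatrix},$$ and $A_i^-(a)=A_i^+(a-e_i)^{-1}$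 for all $i$. For $p\in\mathbb Z^5$ and any lattice path $0=p_0,p_1,\dots,p_m=p$ with $p_k-p_{k-1}=\varepsilon_ke_{i_k}$, $\varepsilon_k=\pm$, put $A(a;p)=A_{i_m}^{\varepsilon_m}(a+p_{m-1})\cdots A_{i_1}^{\varepsilon_1}(a+p_0)$; this does not depend on the path. Let $(r_1(a;p),\,r(a;p))$ be the upper row of $A(a;p)$ and $$\Delta(a;p,q)=r_1(a;p)\,r(a;q)-r(a;p)\,r_1(a;q),\qquad \delta(a;p)=\frac{(-1)^{p_0+p_1+p_2}\,(s(a)-1,s(p))\prod_{i=0}^2(a_i,p_i)}{\prod_{i=0}^2\prod_{j=3}^4(a_j-a_i,\,p_j-p_i)},$$ where in the last formula $p=(p_0,p_1,p_2;p_3,p_4)$ and $(x,n)=\Gamma(x+n)/\Gamma(x)\in\mathbb Q(x)$ for $n\in\mathbb Z$. **Proposition.** Let $p,q\in\mathbb Z^5$ be distinct. 1. $\Delta(a;p,q)=\delta(a;p)\,r(a+p;q-p)$, and it is nonzero in $\mathbb Q(a)$. 2. Let $K$ be a field of meromorphic functions of $a\in\mathbb C^5$ which is mapped into itself by the translation $g(a)\mapsto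 g(a+\mathbf 1)$ and over which $a_0,\dots,a_4$ are algebraically independent. Then, for each of the six companions $h$, the functions $h(a+p)$ and $h(a+q)$ are linearly independent over $K(a)$. 3. There are $u,v\in\mathbb Q(a)$ such that $h(a)=u(a)\,h(a+p)+v(a)\,h(a+q)$ for all six companions $h$, namely $$u(a)=\frac{r(a;q)}{\Delta(a;p,q)}=\frac{r(a;q)}{\delta(a;p)\,r(a+p;q-p)},\qquad v(a)=-\frac{r(a;p)}{\Delta(a;p,q)}=-\frac{r(a;p)}{\delta(a;p)\,r(a+p;q-p)},$$ and for each single companion $h$ this pair $(u,v)$ is the only pair of rational functions in $\mathbb Q(a)$ that satisfies the relation. -/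

import Mathlib

namespace HypThreeTerm

/-! ### Parameter vectors and the companions at unit argument -/

/-- The Saalschuetzian index `s(a) = a₃ + a₄ - a₀ - a₁ - a₂`
(for parameters in a field, and also for integer shift vectors). -/
def saal {R : Type*} [CommRing R] (a : Fin 5 → R) : R :=
  a 3 + a 4 - a 0 - a 1 - a 2

/-- The shifted parameter vector `a + p`, for `p ∈ ℤ⁵`. -/
def shift {R : Type*} [CommRing R] (a : Fin 5 → R) (p : Fin 5 → ℤ) : Fin 5 → R :=
  fun i => a i + (p i : R)

/-- Genericness: `a_i ∉ ℤ` and `a_i - a_j ∉ ℤ` for all `i ≠ j`. -/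
def Generic {R : Type*} [CommRing R] (a : Fin 5 → R) : Prop :=
  (∀ i, ∀ n : ℤ, a i ≠ (n : R)) ∧ (∀ i j, i ≠ j → ∀ n : ℤ, a i - a j ≠ (n : R))

/-- The renormalized hypergeometric series
`∑ₖ Γ(a₀+k) Γ(a₁+k) Γ(a₂+k) / (Γ(1+k) Γ(a₃+k) Γ(a₄+k)) zᵏ`. -/
noncomputable def hgf (a : Fin 5 → ℂ) (z : ℂ) : ℂ :=
  ∑' k : ℕ, Complex.Gamma (a 0 + k) * Complex.Gamma (a 1 + k) * Complex.Gamma (a 2 + k) /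
    (Complex.Gamma (1 + k) * Complex.Gamma (a 3 + k) * Complex.Gamma (a 4 + k)) * z ^ k

/-- The singular points `z = 0` and `z = ∞` of the hypergeometric equation. -/
inductive SingPt
  | zero
  | infty

/-- The six parameter involutions `σ_i^{(ν)}`, `ν ∈ {0, ∞}`, `i = 0, 1, 2`. -/
def invol : SingPt → Fin 3 → (Fin 5 → ℂ) → (Fin 5 → ℂ)
  | .zero, 0, a => a
  | .zero, 1, a => ![a 0 + 1 - a 3, a 1 + 1 - a 3, a 2 + 1 - a 3, 2 - a 3, a 4 + 1 - a 3]
  | .zero, 2, a => ![a 0 + 1 - a 4, a 1 + 1 - a 4, a 2 + 1 - a 4, a 3 + 1 - a 4, 2 - a 4]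
  | .infty, 0, a => ![a 0, a 0 + 1 - a 3, a 0 + 1 - a 4, a 0 + 1 - a 1, a 0 + 1 - a 2]
  | .infty, 1, a => ![a 1 + 1 - a 3, a 1, a 1 + 1 - a 4, a 1 + 1 - a 0, a 1 + 1 - a 2]
  | .infty, 2, a => ![a 2 + 1 - a 4, a 2 + 1 - a 3, a 2, a 2 + 1 - a 1, a 2 + 1 - a 0]

/-- The six solutions `y_i^{(ν)}(a; z)` of the third-order hypergeometric equation:
`z^{1-b_i} hgf(σ_i^{(0)}(a); z)` with `(b₀, b₁, b₂) = (1, a₃, a₄)` at `z = 0`, and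
`e^{iπ s(a)} z^{-a_i} hgf(σ_i^{(∞)}(a); 1/z)` at `z = ∞`. -/
noncomputable def sol : SingPt → Fin 3 → (Fin 5 → ℂ) → ℂ → ℂ
  | .zero, i, a, z => z ^ (1 - (![1, a 3, a 4] : Fin 3 → ℂ) i) * hgf (invol .zero i a) z
  | .infty, i, a, z => Complex.exp (Complex.I * Real.pi * saal a) *
      z ^ (-(![a 0, a 1, a 2] : Fin 3 → ℂ) i) * hgf (invol .infty i a) (1 / z)

/-- The six companions `y_i^{(ν)}(a) = y_i^{(ν)}(a; 1)`. -/
noncomputable def companion (ν : SingPt) (i : Fin 3) (a : Fin 5 → ℂ) : ℂ :=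
  sol ν i a 1

/-- The set of generic `a ∈ ℂ⁵` such that the series of the companions converge at `a + p`,
that is, `Re s(a + p) > 0`. -/
def convSet (p : Fin 5 → ℤ) : Set (Fin 5 → ℂ) :=
  {a | Generic a ∧ 0 < (saal (shift a p)).re}

/-! ### Contiguous matrices and connection matrices -/

section Matrices

variable {F : Type*} [Field F]

/-- `A_i^+(a)` for `i = 0, 1, 2`, where `x = a_i`, `{y, z} = {a_j, a_k}`,
`{i, j, k} = {0, 1, 2}` and `(b, c) = (a₃, a₄)`. -/
def numUp (x y z b c : F) : Matrix (Fin 2) (Fin 2) F :=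
  !![x, 1;
     x * y * z / (b + c - x - y - z - 2),
     (y * z - (x - b + 1) * (x - c + 1)) / (b + c - x - y - z - 2)]

/-- `A_i^-(a)` for `i = 0, 1, 2`, with the same conventions. -/
def numDown (x y z b c : F) : Matrix (Fin 2) (Fin 2) F :=
  !![((x - b) * (x - c) - y * z) / ((x - 1) * (x - b) * (x - c)),
     (b + c - x - y - z - 1) / ((x - 1) * (x - b) * (x - c));
     y * z / ((x - b) * (x - c)),
     -((b + c - x - y - z - 1) / ((x - b) * (x - c)))]

/-- `A_i^+(a)` for `i = 3, 4`, where `b = a_i`, `c` is the other denominator parameter and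
`(x, y, z) = (a₀, a₁, a₂)`. -/
def denUp (b c x y z : F) : Matrix (Fin 2) (Fin 2) F :=
  !![(b ^ 2 - (x + y + z) * b + (x * y + y * z + z * x)) / ((b - x) * (b - y) * (b - z)),
     -((b + c - x - y - z - 1) / ((b - x) * (b - y) * (b - z)));
     -(x * y * z / ((b - x) * (b - y) * (b - z))),
     b * (b + c - x - y - z - 1) / ((b - x) * (b - y) * (b - z))]

/-- `A_i^-(a)` for `i = 3, 4`, with the same conventions. -/
def denDown (b c x y z : F) : Matrix (Fin 2) (Fin 2) F :=
  !![b - 1, 1;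
     x * y * z / (b + c - x - y - z - 2),
     ((b - 1) ^ 2 - (x + y + z) * (b - 1) + (x * y + y * z + z * x)) /
       (b + c - x - y - z - 2)]

/-- The contiguous matrix `A_i^ε(a)`; the sign `ε = +` is `true` and `ε = -` is `false`. -/
def contig (a : Fin 5 → F) : Fin 5 → Bool → Matrix (Fin 2) (Fin 2) F
  | 0, true => numUp (a 0) (a 1) (a 2) (a 3) (a 4)
  | 1, true => numUp (a 1) (a 2) (a 0) (a 3) (a 4)
  | 2, true => numUp (a 2) (a 0) (a 1) (a 3) (a 4)
  | 3, true => denUp (a 3) (a 4) (a 0) (a 1) (a 2)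
  | 4, true => denUp (a 4) (a 3) (a 0) (a 1) (a 2)
  | 0, false => numDown (a 0) (a 1) (a 2) (a 3) (a 4)
  | 1, false => numDown (a 1) (a 2) (a 0) (a 3) (a 4)
  | 2, false => numDown (a 2) (a 0) (a 1) (a 3) (a 4)
  | 3, false => denDown (a 3) (a 4) (a 0) (a 1) (a 2)
  | 4, false => denDown (a 4) (a 3) (a 0) (a 1) (a 2)

/-- The lattice step `ε e_i`. -/
def step (i : Fin 5) (ε : Bool) : Fin 5 → ℤ :=
  Pi.single i (if ε then 1 else -1)

/-- The end point of the lattice path that starts at the origin and takes the listed steps. -/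
def endPt : List (Fin 5 × Bool) → (Fin 5 → ℤ)
  | [] => 0
  | (i, ε) :: w => step i ε + endPt w

/-- The product `A_{i_m}^{ε_m}(a + p_{m-1}) ⋯ A_{i_2}^{ε_2}(a + p_1) A_{i_1}^{ε_1}(a)` along
a lattice path. -/
def pathMat (a : Fin 5 → F) : List (Fin 5 × Bool) → Matrix (Fin 2) (Fin 2) F
  | [] => 1
  | (i, ε) :: w => pathMat (shift a (step i ε)) w * contig a i ε

/-- A lattice path from the origin to `p`, moving along one axis after the other. -/
def axisPath (p : Fin 5 → ℤ) : List (Fin 5 × Bool) :=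
  (List.finRange 5).flatMap fun i => List.replicate (p i).natAbs (i, decide (0 ≤ p i))

/-- The connection matrix `A(a; p)`. It is independent of the lattice path from the origin to `p`
(`pathMat_eq_connMat`). -/
def connMat (a : Fin 5 → F) (p : Fin 5 → ℤ) : Matrix (Fin 2) (Fin 2) F :=
  pathMat a (axisPath p)

/-- `r₁(a; p)`, the upper left entry of `A(a; p)`. -/
def rOne (a : Fin 5 → F) (p : Fin 5 → ℤ) : F := connMat a p 0 0

/-- `r(a; p)`, the upper right entry of `A(a; p)`. -/
def rTwo (a : Fin 5 → F) (p : Fin 5 → ℤ) : F := connMat a p 0 1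

/-- The determinant `Δ(a; p, q)`. -/
def bigDelta (a : Fin 5 → F) (p q : Fin 5 → ℤ) : F :=
  Matrix.det !![rOne a p, rTwo a p; rOne a q, rTwo a q]

/-- The factorial `(x, n) = Γ(x + n) / Γ(x)`, `n ∈ ℤ`, as a rational function of `x`. -/
def poch (x : F) : ℤ → F
  | Int.ofNat m => ∏ k ∈ Finset.range m, (x + (k : F))
  | Int.negSucc m => (∏ k ∈ Finset.range (m + 1), (x - ((k : F) + 1)))⁻¹

/-- `δ(a; p)`, the closed form of `det A(a; p)`. -/
def smallDelta (a : Fin 5 → F) (p : Fin 5 → ℤ) : F :=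
  (-1) ^ (p 0 + p 1 + p 2) * poch (saal a - 1) (saal p) *
      (∏ i ∈ ({0, 1, 2} : Finset (Fin 5)), poch (a i) (p i)) /
    ∏ i ∈ ({0, 1, 2} : Finset (Fin 5)), ∏ j ∈ ({3, 4} : Finset (Fin 5)),
      poch (a j - a i) (p j - p i)

/-! #### Independence of the lattice path -/

lemma shift_shift (a : Fin 5 → F) (p q : Fin 5 → ℤ) :
    shift (shift a p) q = shift a (p + q) := by
  funext i; simp [shift, add_assoc]

lemma shift_zero (a : Fin 5 → F) : shift a 0 = a := by
  funext i; simp [shift]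

/-- No denominator and no determinant of a contiguous matrix vanishes at an integer shift
of `a`. -/
def Regular (a : Fin 5 → F) : Prop :=
  Generic a ∧ ∀ n : ℤ, saal a ≠ (n : F)

lemma Regular.shift {a : Fin 5 → F} (h : Regular a) (p : Fin 5 → ℤ) :
    Regular (shift a p) := by
  obtain ⟨⟨h1, h2⟩, h3⟩ := h
  refine ⟨⟨fun i n e => h1 i (n - p i) ?_, fun i j hij n e => h2 i j hij (n - p i + p j) ?_⟩,
    fun n e => h3 (n - saal p) ?_⟩
  · simp only [HypThreeTerm.shift] at e; push_cast; linear_combination e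
  · simp only [HypThreeTerm.shift] at e; push_cast; linear_combination e
  · simp only [HypThreeTerm.shift, saal] at e ⊢; push_cast; linear_combination e

lemma num_mul_one {x y z b c : F} (h0 : x ≠ 0) (h1 : x + 1 - b ≠ 0) (h2 : x + 1 - c ≠ 0)
    (h3 : b + c - x - y - z - 2 ≠ 0) :
    numDown (x + 1) y z b c * numUp x y z b c = 1 := by
  have h3' : b + c - (x + 1) - y - z - 1 ≠ 0 := fun e => h3 (by linear_combination e)
  have h0' : x + 1 - 1 ≠ 0 := fun e => h0 (by linear_combination e)
  ext i j
  fin_cases i <;> fin_cases j <;>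
    simp [numDown, numUp, Matrix.mul_apply, Fin.sum_univ_two] <;> field_simp <;> ring

lemma den_mul_one {b c x y z : F} (h0 : b + c - x - y - z - 1 ≠ 0) (h1 : b - x ≠ 0)
    (h2 : b - y ≠ 0) (h3 : b - z ≠ 0) :
    denDown (b + 1) c x y z * denUp b c x y z = 1 := by
  have h0' : b + 1 + c - x - y - z - 2 ≠ 0 := fun e => h0 (by linear_combination e)
  ext i j
  fin_cases i <;> fin_cases j <;>
    simp [denDown, denUp, Matrix.mul_apply, Fin.sum_univ_two] <;> field_simp <;> ring

lemma num_num {x y z b c : F} (h0 : b + c - x - y - z - 2 ≠ 0)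
    (h1 : b + c - x - y - z - 3 ≠ 0) :
    numUp y z (x + 1) b c * numUp x y z b c = numUp x (y + 1) z b c * numUp y z x b c := by
  have e1 : b + c - y - z - (x + 1) - 2 = b + c - x - y - z - 3 := by ring
  have e2 : b + c - x - (y + 1) - z - 2 = b + c - x - y - z - 3 := by ring
  have e3 : b + c - y - z - x - 2 = b + c - x - y - z - 2 := by ring
  ext i j
  fin_cases i <;> fin_cases j <;>
    simp [numUp, Matrix.mul_apply, Fin.sum_univ_two, e1, e2, e3] <;> field_simp <;> ring

lemma den_num {x y z b c : F} (h0 : b + c - x - y - z - 2 ≠ 0)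
    (h0' : b + c - x - y - z - 1 ≠ 0)
    (h1 : b - x ≠ 0) (h1' : b - x - 1 ≠ 0) (h2 : b - y ≠ 0) (h3 : b - z ≠ 0) :
    denUp b c (x + 1) y z * numUp x y z b c = numUp x y z (b + 1) c * denUp b c x y z := by
  have e1 : b + c - (x + 1) - y - z - 1 = b + c - x - y - z - 2 := by ring
  have e2 : b + 1 + c - x - y - z - 2 = b + c - x - y - z - 1 := by ring
  have e3 : b - (x + 1) = b - x - 1 := by ring
  ext i j
  fin_cases i <;> fin_cases j <;>
    simp [numUp, denUp, Matrix.mul_apply, Fin.sum_univ_two, e1, e2, e3] <;> field_simp <;> ring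

lemma den_den {x y z b c : F} (h1 : b - x ≠ 0) (h2 : b - y ≠ 0) (h3 : b - z ≠ 0)
    (h4 : c - x ≠ 0) (h5 : c - y ≠ 0) (h6 : c - z ≠ 0) :
    denUp c (b + 1) x y z * denUp b c x y z = denUp b (c + 1) x y z * denUp c b x y z := by
  ext i j
  fin_cases i <;> fin_cases j <;>
    simp [denUp, Matrix.mul_apply, Fin.sum_univ_two] <;> field_simp <;> ring

lemma numUp_swap (x y z b c : F) : numUp x y z b c = numUp x z y b c := by
  ext i j
  fin_cases i <;> fin_cases j <;> simp [numUp] <;> ring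

lemma numUp_swap' (x y z b c : F) : numUp x y z b c = numUp x y z c b := by
  ext i j
  fin_cases i <;> fin_cases j <;> simp [numUp] <;> ring

lemma denUp_rot (b c x y z : F) : denUp b c x y z = denUp b c y z x := by
  ext i j
  fin_cases i <;> fin_cases j <;> simp [denUp] <;> ring

lemma step_not (i : Fin 5) (ε : Bool) : step i ε + step i (!ε) = 0 := by
  cases ε <;> simp [step, ← Pi.single_add]

lemma shift_step (a : Fin 5 → F) (i j : Fin 5) :
    shift a (step i true) j = if j = i then a j + 1 else a j := by
  by_cases h : j = i
  · subst h; simp [shift, step]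
  · simp [shift, step, h]

/-- `A_i^-(a + e_i) A_i^+(a) = 1`. -/
lemma contig_down_up {a : Fin 5 → F} (h : Regular a) (i : Fin 5) :
    contig (shift a (step i true)) i false * contig a i true = 1 := by
  have hd : ∀ i j : Fin 5, i ≠ j → a i - a j ≠ 0 := fun i j hij => by
    simpa using h.1.2 i j hij 0
  have hd1 : ∀ i j : Fin 5, i ≠ j → a i + 1 - a j ≠ 0 := fun i j hij e =>
    h.1.2 i j hij (-1) (by push_cast; linear_combination e)
  have h0 : ∀ i, a i ≠ 0 := fun i => by simpa using h.1.1 i 0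
  have hs : ∀ n : ℤ, a 3 + a 4 - a 0 - a 1 - a 2 ≠ (n : F) := h.2
  fin_cases i <;> simp [contig, shift_step]
  · exact num_mul_one (h0 _) (hd1 _ _ (by decide)) (hd1 _ _ (by decide))
      fun e => hs 2 (by push_cast; linear_combination e)
  · exact num_mul_one (h0 _) (hd1 _ _ (by decide)) (hd1 _ _ (by decide))
      fun e => hs 2 (by push_cast; linear_combination e)
  · exact num_mul_one (h0 _) (hd1 _ _ (by decide)) (hd1 _ _ (by decide))
      fun e => hs 2 (by push_cast; linear_combination e)
  · exact den_mul_one (fun e => hs 1 (by push_cast; linear_combination e))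
      (hd _ _ (by decide)) (hd _ _ (by decide)) (hd _ _ (by decide))
  · exact den_mul_one (fun e => hs 1 (by push_cast; linear_combination e))
      (hd _ _ (by decide)) (hd _ _ (by decide)) (hd _ _ (by decide))

lemma contig_inv {a : Fin 5 → F} (h : Regular a) (i : Fin 5) (ε : Bool) :
    contig (shift a (step i ε)) i (!ε) * contig a i ε = 1 := by
  cases ε
  · have := contig_down_up (h.shift (step i false)) i
    rw [shift_shift, show step i false + step i true = 0 from step_not i false,
      shift_zero] at this
    exact mul_eq_one_comm.mp this
  · exact contig_down_up h i

/-- `A_i^+(a + e_j) A_j^+(a) = A_j^+(a + e_i) A_i^+(a)`. -/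
lemma contig_up_up {a : Fin 5 → F} (h : Regular a) (i j : Fin 5) :
    contig (shift a (step j true)) i true * contig a j true =
      contig (shift a (step i true)) j true * contig a i true := by
  have hd : ∀ i j : Fin 5, i ≠ j → a i - a j ≠ 0 := fun i j hij => by
    simpa using h.1.2 i j hij 0
  have hd1 : ∀ i j : Fin 5, i ≠ j → a i - a j - 1 ≠ 0 := fun i j hij e =>
    h.1.2 i j hij 1 (by push_cast; linear_combination e)
  have hs : ∀ n : ℤ, a 3 + a 4 - a 0 - a 1 - a 2 ≠ (n : F) := h.2
  have s1 : a 3 + a 4 - a 0 - a 1 - a 2 - 1 ≠ 0 :=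
    fun e => hs 1 (by push_cast; linear_combination e)
  have s2 : a 3 + a 4 - a 0 - a 1 - a 2 - 2 ≠ 0 :=
    fun e => hs 2 (by push_cast; linear_combination e)
  have s3 : a 3 + a 4 - a 0 - a 1 - a 2 - 3 ≠ 0 :=
    fun e => hs 3 (by push_cast; linear_combination e)
  have key : ∀ i j : Fin 5, i < j → contig (shift a (step j true)) i true * contig a j true =
      contig (shift a (step i true)) j true * contig a i true := by
    intro i j hij
    have d30 := hd 3 0 (by decide)
    have d31 := hd 3 1 (by decide)
    have d32 := hd 3 2 (by decide)
    have d40 := hd 4 0 (by decide)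
    have d41 := hd 4 1 (by decide)
    have d42 := hd 4 2 (by decide)
    have f30 := hd1 3 0 (by decide)
    have f31 := hd1 3 1 (by decide)
    have f32 := hd1 3 2 (by decide)
    have f40 := hd1 4 0 (by decide)
    have f41 := hd1 4 1 (by decide)
    have f42 := hd1 4 2 (by decide)
    fin_cases i <;> fin_cases j <;> first | (exact absurd hij (by decide)) | skip
    all_goals simp [contig, shift_step]
    · exact (num_num s2 s3).symm
    · exact (num_num (fun e => s2 (by linear_combination e)) (fun e => s3 (by linear_combination e)))
    · exact (den_num s2 s1 d30 f30 d31 d32).symm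
    · rw [numUp_swap' _ _ _ (a 3), numUp_swap' _ _ _ (a 3)]
      exact (den_num (fun e => s2 (by linear_combination e)) (fun e => s1 (by linear_combination e)) d40 f40 d41 d42).symm
    · exact (num_num (fun e => s2 (by linear_combination e)) (fun e => s3 (by linear_combination e))).symm
    · rw [denUp_rot, denUp_rot _ _ (a 0) (a 1 + 1)]
      exact (den_num (fun e => s2 (by linear_combination e)) (fun e => s1 (by linear_combination e)) d31 f31 d32 d30).symm
    · rw [numUp_swap' _ _ _ (a 3), numUp_swap' _ _ _ (a 3), denUp_rot, denUp_rot _ _ (a 0) (a 1 + 1)]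
      exact (den_num (fun e => s2 (by linear_combination e)) (fun e => s1 (by linear_combination e)) d41 f41 d42 d40).symm
    · rw [← denUp_rot, ← denUp_rot _ _ (a 2 + 1)]
      exact (den_num (fun e => s2 (by linear_combination e)) (fun e => s1 (by linear_combination e)) d32 f32 d30 d31).symm
    · rw [numUp_swap' _ _ _ (a 3), numUp_swap' _ _ _ (a 3), ← denUp_rot, ← denUp_rot _ _ (a 2 + 1)]
      exact (den_num (fun e => s2 (by linear_combination e)) (fun e => s1 (by linear_combination e)) d42 f42 d40 d41).symm
    · exact (den_den d30 d31 d32 d40 d41 d42).symm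
  rcases lt_trichotomy i j with hij | hij | hij
  · exact key i j hij
  · rw [hij]
  · exact (key j i hij).symm

/-- The compatibility condition
`A_i^{ε}(a + ε' e_j) A_j^{ε'}(a) = A_j^{ε'}(a + ε e_i) A_i^{ε}(a)`. -/
lemma contig_compat {a : Fin 5 → F} (h : Regular a) (i j : Fin 5) (ε ε' : Bool) :
    contig (shift a (step j ε')) i ε * contig a j ε' =
      contig (shift a (step i ε)) j ε' * contig a i ε := by
  -- a sign at `j` can be reversed by conjugation with inverse matrices
  have flip : ∀ (i j : Fin 5) (ε ε' : Bool),
      (∀ {a : Fin 5 → F}, Regular a → contig (shift a (step j ε')) i ε * contig a j ε' =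
        contig (shift a (step i ε)) j ε' * contig a i ε) →
      ∀ {a : Fin 5 → F}, Regular a →
        contig (shift a (step j (!ε'))) i ε * contig a j (!ε') =
          contig (shift a (step i ε)) j (!ε') * contig a i ε := by
    intro i j ε ε' H a h
    have hb := H (h.shift (step j (!ε')))
    have z : step j (!ε') + step j ε' = 0 := by rw [add_comm]; exact step_not j ε'
    have i1 := contig_inv h j (!ε')
    have i2 := contig_inv ((h.shift (step i ε)).shift (step j (!ε'))) j ε'
    simp only [shift_shift, z, shift_zero] at hb
    simp only [shift_shift, add_assoc, z, add_zero] at i2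
    rw [Bool.not_not] at i1
    have e : step j (!ε') + step i ε = step i ε + step j (!ε') := add_comm _ _
    rw [e] at hb
    calc _ = (contig (shift a (step i ε)) j (!ε') *
          contig (shift a (step i ε + step j (!ε'))) j ε') *
          (contig (shift a (step j (!ε'))) i ε * contig a j (!ε')) := by rw [i2, one_mul]
      _ = contig (shift a (step i ε)) j (!ε') * (contig (shift a (step i ε + step j (!ε'))) j ε' *
          contig (shift a (step j (!ε'))) i ε) * contig a j (!ε') := by
            simp only [mul_assoc]
      _ = contig (shift a (step i ε)) j (!ε') * contig a i ε *
          (contig (shift a (step j (!ε'))) j ε' * contig a j (!ε')) := by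
            rw [← hb]; simp only [mul_assoc]
      _ = _ := by rw [i1, mul_one]
  have up : ∀ (i j : Fin 5) (ε' : Bool) {a : Fin 5 → F}, Regular a →
      contig (shift a (step j ε')) i true * contig a j ε' =
        contig (shift a (step i true)) j ε' * contig a i true := by
    intro i j ε' a h
    cases ε'
    · exact flip i j true true (fun h => contig_up_up h i j) h
    · exact contig_up_up h i j
  cases ε
  · exact (flip j i ε' true (fun h => (up i j ε' h).symm) h).symm
  · exact up i j ε' h

lemma pathMat_append (a : Fin 5 → F) (w w' : List (Fin 5 × Bool)) :
    pathMat a (w ++ w') = pathMat (shift a (endPt w)) w' * pathMat a w := by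
  induction w generalizing a with
  | nil => simp [pathMat, endPt, shift_zero]
  | cons x w ih => simp [pathMat, endPt, ih, shift_shift, mul_assoc]

lemma endPt_append (w w' : List (Fin 5 × Bool)) : endPt (w ++ w') = endPt w + endPt w' := by
  induction w with
  | nil => simp [endPt]
  | cons x w ih => simp [endPt, ih, add_assoc]

lemma endPt_perm {w w' : List (Fin 5 × Bool)} (h : w.Perm w') : endPt w = endPt w' := by
  induction h with
  | nil => rfl
  | cons x _ ih => simp [endPt, ih]
  | swap x y l => simp [endPt, add_left_comm]
  | trans _ _ ih ih' => exact ih.trans ih'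

lemma pathMat_perm {w w' : List (Fin 5 × Bool)} (h : w.Perm w') {a : Fin 5 → F}
    (ha : Regular a) : pathMat a w = pathMat a w' := by
  induction h generalizing a with
  | nil => rfl
  | cons x _ ih => simp [pathMat, ih (ha.shift _)]
  | swap x y l =>
    simp only [pathMat, shift_shift, mul_assoc, contig_compat ha x.1 y.1 x.2 y.2]
    rw [add_comm (step y.1 y.2)]
  | trans _ _ ih ih' => exact (ih ha).trans (ih' ha)

lemma endPt_apply_of_not_mem {w : List (Fin 5 × Bool)} {i : Fin 5} {ε : Bool}
    (h : (i, !ε) ∉ w) : 0 ≤ (if ε then 1 else -1) * endPt w i := by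
  induction w with
  | nil => simp [endPt]
  | cons x w ih =>
    obtain ⟨j, δ⟩ := x
    simp only [List.mem_cons, not_or, Prod.mk.injEq, not_and] at h
    have := ih h.2
    simp only [endPt, Pi.add_apply, mul_add]
    refine add_nonneg ?_ this
    by_cases hj : i = j
    · subst hj
      have := h.1 rfl
      cases ε <;> cases δ <;> simp_all [step]
    · simp [step, hj]

/-- The product along a closed path is the identity matrix. -/
lemma pathMat_loop {a : Fin 5 → F} (ha : Regular a) (w : List (Fin 5 × Bool))
    (h : endPt w = 0) : pathMat a w = 1 := by
  induction hn : w.length using Nat.strong_induction_on generalizing w with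
  | _ n ih =>
    match w with
    | [] => rfl
    | (i, ε) :: w =>
      have hm : (i, !ε) ∈ w := by
        by_contra hm
        have h1 := endPt_apply_of_not_mem hm
        have h2 := congrFun h i
        simp only [endPt, Pi.add_apply, Pi.zero_apply, step, Pi.single_eq_same] at h2
        cases ε <;> simp at h1 h2 <;> omega
      have hp := List.perm_cons_erase hm
      have hp' := hp.cons (i, ε)
      rw [pathMat_perm hp' ha]
      have h3 : endPt (w.erase (i, !ε)) = 0 := by
        rw [endPt_perm hp'] at h
        simpa only [endPt, ← add_assoc, step_not, zero_add] using h
      simp only [pathMat, shift_shift, step_not, shift_zero, mul_assoc, contig_inv ha i ε,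
        mul_one]
      refine ih _ ?_ _ h3 rfl
      have := hp.length_eq
      simp only [List.length_cons] at this hn
      omega

/-- The path with all steps inverted. -/
def revPath (w : List (Fin 5 × Bool)) : List (Fin 5 × Bool) :=
  (w.map fun x => (x.1, !x.2))

lemma endPt_revPath (w : List (Fin 5 × Bool)) : endPt (revPath w) = -endPt w := by
  induction w with
  | nil => simp [endPt, revPath]
  | cons x w ih =>
    have : step x.1 (!x.2) = -step x.1 x.2 :=
      eq_neg_of_add_eq_zero_right (step_not x.1 x.2)
    simp only [revPath, List.map_cons, endPt] at ih ⊢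
    rw [ih, this]; abel

/-- The product depends only on the end point of the path. -/
lemma pathMat_eq_of_endPt_eq {a : Fin 5 → F} (ha : Regular a) {w w' : List (Fin 5 × Bool)}
    (h : endPt w = endPt w') : pathMat a w = pathMat a w' := by
  have h1 : pathMat a (w' ++ (revPath w' ++ w)) = pathMat a w' := by
    rw [pathMat_append, pathMat_loop (ha.shift _), one_mul]
    rw [endPt_append, endPt_revPath, h]; simp
  have h2 : pathMat a ((w' ++ revPath w') ++ w) = pathMat a w := by
    have h0 : endPt (w' ++ revPath w') = 0 := by rw [endPt_append, endPt_revPath]; simp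
    rw [pathMat_append, pathMat_loop ha _ h0, mul_one, h0, shift_zero]
  rw [← h1, ← h2, List.append_assoc]

lemma endPt_axisPath (p : Fin 5 → ℤ) : endPt (axisPath p) = p := by
  have hrep : ∀ (i : Fin 5) (ε : Bool) (n : ℕ),
      endPt (List.replicate n (i, ε)) = n • step i ε := by
    intro i ε n
    induction n with
    | zero => simp [endPt]
    | succ n ih => rw [List.replicate_succ, endPt, ih, succ_nsmul']
  have hst : ∀ i : Fin 5, (p i).natAbs • step i (decide (0 ≤ p i)) = Pi.single i (p i) := by
    intro i
    rw [step, ← Pi.single_smul]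
    congr 1
    by_cases h : 0 ≤ p i
    · simp [h]
    · simp [h, abs_of_neg (not_le.mp h)]
  have : axisPath p = List.replicate (p 0).natAbs (0, decide (0 ≤ p 0)) ++
      (List.replicate (p 1).natAbs (1, decide (0 ≤ p 1)) ++
      (List.replicate (p 2).natAbs (2, decide (0 ≤ p 2)) ++
      (List.replicate (p 3).natAbs (3, decide (0 ≤ p 3)) ++
      (List.replicate (p 4).natAbs (4, decide (0 ≤ p 4)))))) := by
    simp [axisPath, List.finRange_succ, List.flatMap_cons]
  rw [this]
  simp only [endPt_append, hrep, hst]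
  funext i
  fin_cases i <;> simp

/-- The connection matrix may be computed along any lattice path from the origin to `p`. -/
theorem pathMat_eq_connMat {a : Fin 5 → F} (ha : Regular a) {w : List (Fin 5 × Bool)}
    {p : Fin 5 → ℤ} (h : endPt w = p) : pathMat a w = connMat a p :=
  pathMat_eq_of_endPt_eq ha (h.trans (endPt_axisPath p).symm)

end Matrices

/-! ### The rational function field `ℚ(a)` and its elements as functions on `ℂ⁵` -/

/-- The rational function field `ℚ(a) = ℚ(a₀, a₁, a₂, a₃, a₄)`. -/
abbrev RatA : Type := FractionRing (MvPolynomial (Fin 5) ℚ)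

/-- The vector `a = (a₀, a₁, a₂; a₃, a₄)` of variables of `ℚ(a)`. -/
noncomputable def varA : Fin 5 → RatA :=
  fun i => algebraMap (MvPolynomial (Fin 5) ℚ) RatA (MvPolynomial.X i)

/-- The variables of `ℚ(a)` satisfy the hypotheses of `pathMat_eq_connMat`. -/
theorem regular_varA : Regular varA := by
  have key : ∀ (P : MvPolynomial (Fin 5) ℚ) (n : ℤ) (x : Fin 5 → ℚ),
      MvPolynomial.eval x P ≠ n → algebraMap (MvPolynomial (Fin 5) ℚ) RatA P ≠ (n : RatA) := by
    intro P n x hx e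
    have : P = (n : MvPolynomial (Fin 5) ℚ) := by
      apply IsFractionRing.injective (MvPolynomial (Fin 5) ℚ) RatA
      rw [e]; simp
    apply hx
    rw [this]; simp
  refine ⟨⟨fun i n => key _ n (fun _ => n + 1) (by simp), fun i j hij n => ?_⟩, fun n => ?_⟩
  · rw [varA, varA, ← map_sub]
    refine key _ n (fun k => if k = i then n + 1 else 0) ?_
    simp [hij.symm]
  · simp only [saal, varA]
    rw [← map_add, ← map_sub, ← map_sub, ← map_sub]
    refine key _ n (fun k => if k = 3 then n + 1 else 0) ?_
    simp

/-- The rational function `u` has no pole at `x ∈ ℂ⁵`: its reduced denominator does not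
vanish at `x`. -/
def RegularAt (u : RatA) (x : Fin 5 → ℂ) : Prop :=
  MvPolynomial.aeval x (IsFractionRing.den (MvPolynomial (Fin 5) ℚ) u :
    MvPolynomial (Fin 5) ℚ) ≠ 0

/-- The value of the rational function `u` at `x ∈ ℂ⁵`. -/
noncomputable def valueAt (u : RatA) (x : Fin 5 → ℂ) : ℂ :=
  MvPolynomial.aeval x (IsFractionRing.num (MvPolynomial (Fin 5) ℚ) u) /
    MvPolynomial.aeval x (IsFractionRing.den (MvPolynomial (Fin 5) ℚ) u :
      MvPolynomial (Fin 5) ℚ)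

/-- The three-term relation `h(a) = u(a) h(a + p) + v(a) h(a + q)`: it holds at every generic `a`
such that the series at `a`, `a + p` and `a + q` converge, and `u` and `v` have no pole
at `a`. -/
def ThreeTermRel (h : (Fin 5 → ℂ) → ℂ) (p q : Fin 5 → ℤ) (u v : RatA) : Prop :=
  ∀ a ∈ convSet 0 ∩ convSet p ∩ convSet q, RegularAt u a → RegularAt v a →
    h a = valueAt u a * h (shift a p) + valueAt v a * h (shift a q)

/-! ### Meromorphic functions on `ℂ⁵` and linear independence -/

/-- The ring of entire functions on `ℂ⁵`. -/
def Entire : Subalgebra ℂ ((Fin 5 → ℂ) → ℂ) where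
  carrier := {f | AnalyticOnNhd ℂ f Set.univ}
  mul_mem' hf hg := hf.mul hg
  add_mem' hf hg := hf.add hg
  algebraMap_mem' _ := analyticOnNhd_const

instance : NoZeroDivisors Entire where
  eq_zero_or_eq_zero_of_mul_eq_zero := by
    intro f g h
    by_contra! hc
    obtain ⟨hf, hg⟩ := hc
    apply hg
    obtain ⟨x, hx⟩ : ∃ x, f.1 x ≠ 0 := by
      by_contra! hx
      exact hf (Subtype.ext (funext hx))
    apply Subtype.ext
    refine AnalyticOnNhd.eq_of_eventuallyEq (z₀ := x) g.2 analyticOnNhd_const ?_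
    have hfx : ∀ᶠ y in nhds x, f.1 y ≠ 0 :=
      (f.2 x (Set.mem_univ x)).continuousAt.eventually_ne hx
    filter_upwards [hfx] with y hy
    have : f.1 y * g.1 y = 0 := congrFun (congrArg Subtype.val h) y
    exact (mul_eq_zero.mp this).resolve_left hy

instance : IsDomain Entire := NoZeroDivisors.to_isDomain _

/-- The field of meromorphic functions on `ℂ⁵`. Every meromorphic function on `ℂⁿ` is a quotient of
two entire functions (Poincare, Cousin). -/
abbrev Mero : Type := FractionRing Entire

/-- The coordinate function `a_i` as a meromorphic function. -/
noncomputable def coordA (i : Fin 5) : Mero :=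
  algebraMap Entire Mero
    ⟨fun a => a i, (ContinuousLinearMap.proj (R := ℂ) (φ := fun _ : Fin 5 => ℂ) i).analyticOnNhd _⟩

/-- The translation `f(a) ↦ f(a + 𝟏)` on entire functions, where `𝟏 = (1,1,1;1,1)`. -/
def translateEntire : Entire →+* Entire where
  toFun f := ⟨fun a => f.1 (a + 1), fun a _ =>
    (f.2 (a + 1) (Set.mem_univ _)).fun_comp (f := fun a : Fin 5 → ℂ => a + 1)
      (analyticAt_id.add analyticAt_const)⟩
  map_one' := rfl
  map_mul' _ _ := rfl
  map_zero' := rfl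
  map_add' _ _ := rfl

lemma translateEntire_injective : Function.Injective translateEntire := by
  intro f g h
  apply Subtype.ext
  funext a
  have := congrFun (congrArg Subtype.val h) (a - 1)
  simpa [translateEntire] using this

/-- The translation `f(a) ↦ f(a + 𝟏)` on meromorphic functions. -/
noncomputable def meroShift : Mero →+* Mero :=
  IsFractionRing.map translateEntire_injective

/-- The field `K(a)` generated by `K` and the coordinate functions. -/
noncomputable def adjoinA (K : Subfield Mero) : Subfield Mero :=
  Subfield.closure ((K : Set Mero) ∪ Set.range coordA)

/-- The relation `x f + y g = 0` on `U`, for meromorphic functions `x`, `y` on `ℂ⁵` and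
functions `f`, `g` on `U`; it is written with a common denominator of `x` and `y`. -/
def LinRel (U : Set (Fin 5 → ℂ)) (f g : (Fin 5 → ℂ) → ℂ) (x y : Mero) : Prop :=
  ∃ X Y Z : Entire, Z ≠ 0 ∧ x = algebraMap Entire Mero X / algebraMap Entire Mero Z ∧
    y = algebraMap Entire Mero Y / algebraMap Entire Mero Z ∧
    ∀ a ∈ U, X.1 a * f a + Y.1 a * g a = 0

/-- The functions `f` and `g` on `U` are linearly independent over the field `L` of meromorphic
functions on `ℂ⁵`. -/
def LinIndepOver (L : Subfield Mero) (U : Set (Fin 5 → ℂ)) (f g : (Fin 5 → ℂ) → ℂ) : Prop :=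
  ∀ x ∈ L, ∀ y ∈ L, LinRel U f g x y → x = 0 ∧ y = 0

end HypThreeTerm

open HypThreeTerm

/-!
The contiguity relations of the series carry the pair `(h(a), h(a + 𝟏))` along lattice paths by the
contiguous matrices, in the same way for all six companions `h`. So `h(a + p)` and `h(a + q)` are
given in terms of this pair by the upper rows of `A(a; p)` and `A(a; q)`, whose determinant is
`Δ(a; p, q)`. Multiplicativity of `A` gives `Δ(a; p, q) = det A(a; p) r(a + p; q - p)`.

If `r(a; p)` were identically zero, then `A(a; p)` would be diagonal, and its compatibility with
`A(a; 𝟏)` would make `p` a period of `ψ(a) ψ(a + 𝟏) / (φ₃(a + 𝟏) (s(a) - 2))`, which forces `p = 0`.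

A linear relation between `h(a + p)` and `h(a + q)` over `K(a)` amounts to a relation between `h(a)`
and `h(a + 𝟏)`, that is, to a solution in `K(a)` of the Riccati equation attached to the recurrence
in the direction `𝟏`. With the weights `1, 1, 1, 2, 0` for `a₀, …, a₄` there is none, for reasons of
degree. Applied to `K = ℚ`, the independence shows the uniqueness of the three-term relation.
-/

namespace HypThreeTerm
open Filter Topology Asymptotics

/-! ### The hypergeometric series at unit argument -/

lemma Generic.shift {R : Type*} [CommRing R] {a : Fin 5 → R} (h : Generic a) (p : Fin 5 → ℤ) :
    Generic (shift a p) := by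
  refine ⟨fun i n e => h.1 i (n - p i) ?_, fun i j hij n e => h.2 i j hij (n - p i + p j) ?_⟩ <;>
  · simp only [HypThreeTerm.shift] at e
    push_cast
    linear_combination e

lemma saal_shift {R : Type*} [CommRing R] (a : Fin 5 → R) (p : Fin 5 → ℤ) :
    saal (shift a p) = saal a + ((saal p : ℤ) : R) := by
  simp only [saal, shift]
  push_cast
  ring

lemma saal_add (p q : Fin 5 → ℤ) : saal (p + q) = saal p + saal q := by
  simp only [saal, Pi.add_apply]
  ring

lemma saal_one : saal (1 : Fin 5 → ℤ) = -1 := rfl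

lemma shift_one_shift_one {F : Type*} [Field F] (a : Fin 5 → F) :
    shift (shift a 1) 1 = shift a 2 :=
  shift_shift a 1 1

lemma shift_step_false {F : Type*} [Field F] (a : Fin 5 → F) (i j : Fin 5) :
    shift a (step i false) j = if j = i then a j - 1 else a j := by
  rcases eq_or_ne j i with rfl | h
  · simp [shift, step, sub_eq_add_neg]
  · simp [shift, step, h]

lemma re_saal_shift (a : Fin 5 → ℂ) (p : Fin 5 → ℤ) :
    (saal (shift a p)).re = (saal a).re + (saal p : ℤ) := by
  rw [saal_shift, Complex.add_re, Complex.intCast_re]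

lemma re_saal_shift_one (a : Fin 5 → ℂ) : (saal (shift a 1)).re = (saal a).re - 1 := by
  rw [re_saal_shift, saal_one, Int.cast_neg, Int.cast_one, sub_eq_add_neg]

lemma Generic.ne_neg_nat {a : Fin 5 → ℂ} (h : Generic a) (i : Fin 5) (m : ℕ) : a i ≠ -m := by
  simpa using h.1 i (-m)

lemma Generic.add_nat_ne_zero {a : Fin 5 → ℂ} (h : Generic a) (i : Fin 5) (m : ℕ) :
    a i + m ≠ 0 :=
  fun e => h.ne_neg_nat i m (eq_neg_of_add_eq_zero_left e)

lemma Generic.Gamma_ne_zero {a : Fin 5 → ℂ} (h : Generic a) (i : Fin 5) (k : ℕ) :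
    Complex.Gamma (a i + k) ≠ 0 :=
  Complex.Gamma_ne_zero fun m e => h.ne_neg_nat i (k + m) (by push_cast; linear_combination e)

/-- The coefficient of `zᵏ` in the renormalized hypergeometric series `hgf a z`. -/
noncomputable def hgTerm (a : Fin 5 → ℂ) (k : ℕ) : ℂ :=
  Complex.Gamma (a 0 + k) * Complex.Gamma (a 1 + k) * Complex.Gamma (a 2 + k) /
    (Complex.Gamma (1 + k) * Complex.Gamma (a 3 + k) * Complex.Gamma (a 4 + k))

lemma hgf_one (a : Fin 5 → ℂ) : hgf a 1 = ∑' k, hgTerm a k := by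
  simp only [hgf, hgTerm, one_pow, mul_one]

lemma Gamma_add_nat_succ {s : ℂ} (hs : ∀ m : ℕ, s ≠ -m) (n : ℕ) :
    Complex.Gamma (s + (n + 1 : ℕ)) = (∏ j ∈ Finset.range (n + 1), (s + j)) * Complex.Gamma s := by
  have hstep (m : ℕ) : Complex.Gamma (s + (m + 1 : ℕ)) = (s + m) * Complex.Gamma (s + m) := by
    rw [← Complex.Gamma_add_one _ fun e => hs m (eq_neg_of_add_eq_zero_left e)]
    push_cast
    rw [add_assoc]
  generalize n + 1 = m
  induction m with
  | zero => simp
  | succ m ih => rw [hstep, ih, Finset.prod_range_succ]; ring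

lemma isEquivalent_Gamma_add_nat {s : ℂ} (hs : ∀ m : ℕ, s ≠ -m) :
    (fun n : ℕ => Complex.Gamma (s + (n + 1 : ℕ))) ~[atTop]
      fun n : ℕ => (n.factorial : ℂ) * (n : ℂ) ^ s := by
  have hG := Complex.Gamma_ne_zero hs
  have h := (Complex.GammaSeq_tendsto_Gamma s).inv₀ hG |>.const_mul (Complex.Gamma s)
  rw [mul_inv_cancel₀ hG] at h
  refine isEquivalent_of_tendsto_one (h.congr fun n => ?_)
  rw [Pi.div_apply, Gamma_add_nat_succ hs, Complex.GammaSeq, inv_div, ← mul_div_assoc]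
  congr 1 <;> ring

lemma isEquivalent_hgTerm {a : Fin 5 → ℂ} (ha : Generic a) :
    (fun n : ℕ => hgTerm a (n + 1)) ~[atTop] fun n : ℕ => (n : ℂ) ^ (-saal a - 1) := by
  have g i := isEquivalent_Gamma_add_nat (ha.ne_neg_nat i)
  have g1 := isEquivalent_Gamma_add_nat (s := 1) fun m e => by
    have h : (1 : ℝ) = -m := by simpa using congrArg Complex.re e
    linarith [m.cast_nonneg (α := ℝ)]
  refine ((((g 0).mul (g 1)).mul (g 2)).div ((g1.mul (g 3)).mul (g 4))).congr_right ?_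
  filter_upwards [eventually_ne_atTop 0] with n hn
  have hn0 : (n : ℂ) ≠ 0 := Nat.cast_ne_zero.2 hn
  have hf : (n.factorial : ℂ) ≠ 0 := Nat.cast_ne_zero.2 n.factorial_ne_zero
  have hc i : (n : ℂ) ^ a i ≠ 0 := by simp [Complex.cpow_eq_zero_iff, hn0]
  have hpow : (n : ℂ) ^ (-saal a - 1) =
      (n : ℂ) ^ a 0 * (n : ℂ) ^ a 1 * (n : ℂ) ^ a 2 / (n * (n : ℂ) ^ a 3 * (n : ℂ) ^ a 4) := by
    rw [show -saal a - 1 = a 0 + a 1 + a 2 - (1 + a 3 + a 4) by simp only [saal]; ring]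
    simp only [Complex.cpow_sub _ _ hn0, Complex.cpow_add _ _ hn0, Complex.cpow_one]
  simp only [Pi.div_apply, Pi.mul_apply, hpow, Complex.cpow_one]
  have h3 := hc 3
  have h4 := hc 4
  field_simp

lemma summable_hgTerm {a : Fin 5 → ℂ} (ha : Generic a) (hs : 0 < (saal a).re) :
    Summable (hgTerm a) := by
  rw [← summable_nat_add_iff 1]
  have hsum : Summable fun n : ℕ => (n : ℝ) ^ (-(saal a).re - 1) :=
    Real.summable_nat_rpow.2 (by linarith)
  refine summable_of_isBigO_nat hsum ((isEquivalent_hgTerm ha).isBigO.trans ?_)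
  refine IsBigO.of_bound 1 ?_
  filter_upwards [eventually_gt_atTop 0] with n hn
  rw [Complex.norm_natCast_cpow_of_pos hn, one_mul, Complex.sub_re, Complex.neg_re, Complex.one_re]
  exact Real.le_norm_self _

lemma hasSum_hgTerm {a : Fin 5 → ℂ} (ha : Generic a) (hs : 0 < (saal a).re) :
    HasSum (hgTerm a) (hgf a 1) :=
  hgf_one a ▸ (summable_hgTerm ha hs).hasSum

lemma Gamma_one_add_succ (k : ℕ) :
    Complex.Gamma (1 + (k + 1 : ℕ)) = (k + 1 : ℕ) * Complex.Gamma (1 + k) := by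
  rw [add_comm, Complex.Gamma_add_one _ (Nat.cast_ne_zero.2 k.succ_ne_zero), Nat.cast_succ,
    add_comm (k : ℂ)]

lemma hgTerm_shift_one (a : Fin 5 → ℂ) (k : ℕ) :
    hgTerm (shift a 1) k = hgTerm a (k + 1) * (k + 1 : ℕ) := by
  have e (x : ℂ) : x + 1 + k = x + (k + 1 : ℕ) := by push_cast; ring
  have hk : ((k + 1 : ℕ) : ℂ) ≠ 0 := Nat.cast_ne_zero.2 k.succ_ne_zero
  simp only [hgTerm, shift, Pi.one_apply, Int.cast_one, e, Gamma_one_add_succ]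
  generalize ((k + 1 : ℕ) : ℂ) = N at *
  field_simp

lemma hgTerm_succ {a : Fin 5 → ℂ} (ha : Generic a) (k : ℕ) :
    hgTerm a (k + 1) * (k + 1) * (a 3 + k) * (a 4 + k) =
      (a 0 + k) * (a 1 + k) * (a 2 + k) * hgTerm a k := by
  have e i : Complex.Gamma (a i + (k + 1 : ℕ)) = (a i + k) * Complex.Gamma (a i + k) := by
    rw [← Complex.Gamma_add_one _ (ha.add_nat_ne_zero i k), Nat.cast_succ, add_assoc]
  have h1 : Complex.Gamma (1 + k) ≠ 0 := Complex.Gamma_ne_zero_of_re_pos <| by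
    simp only [Complex.add_re, Complex.one_re, Complex.natCast_re]
    positivity
  have hk : (k + 1 : ℂ) ≠ 0 := Nat.cast_add_one_ne_zero k
  have g3 := ha.Gamma_ne_zero 3 k
  have g4 := ha.Gamma_ne_zero 4 k
  have n3 := ha.add_nat_ne_zero 3 k
  have n4 := ha.add_nat_ne_zero 4 k
  simp only [hgTerm, e, Gamma_one_add_succ]
  push_cast
  field_simp

lemma hasSum_hgTerm_mul {a : Fin 5 → ℂ} (ha : Generic a) (hs : 1 < (saal a).re) :
    HasSum (fun k : ℕ => hgTerm a k * k) (hgf (shift a 1) 1) := by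
  have h := hasSum_hgTerm (ha.shift 1) (by rw [re_saal_shift_one]; linarith)
  rw [← hasSum_nat_add_iff' 1]
  simpa only [funext (hgTerm_shift_one a), Finset.sum_range_one, Nat.cast_zero, mul_zero,
    sub_zero] using h

lemma hasSum_hgTerm_mul_sub_one {a : Fin 5 → ℂ} (ha : Generic a) (hs : 2 < (saal a).re) :
    HasSum (fun k : ℕ => hgTerm a k * (k * (k - 1))) (hgf (shift a 2) 1) := by
  have h := hasSum_hgTerm_mul (ha.shift 1) (by rw [re_saal_shift_one]; linarith)
  rw [shift_one_shift_one] at h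
  rw [← hasSum_nat_add_iff' 1]
  simpa [hgTerm_shift_one, mul_assoc] using h

lemma hgTerm_up {a : Fin 5 → ℂ} (ha : Generic a) (i : Fin 5) (hi : i < 3) (k : ℕ) :
    hgTerm (shift a (step i true)) k = (a i + k) * hgTerm a k := by
  have e : Complex.Gamma (a i + 1 + k) = (a i + k) * Complex.Gamma (a i + k) := by
    rw [← Complex.Gamma_add_one _ (ha.add_nat_ne_zero i k), add_right_comm]
  simp only [hgTerm, shift_step]
  fin_cases i <;>
    simp only [Fin.zero_eta, Fin.mk_one, Fin.reduceFinMk, Fin.reduceEq, one_ne_zero, zero_ne_one,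
      Fin.reduceLT, if_true, if_false] at hi e ⊢ <;>
    rw [e] <;> ring

lemma hgTerm_down {a : Fin 5 → ℂ} (ha : Generic a) (i : Fin 5) (hi : 3 ≤ i) (k : ℕ) :
    hgTerm (shift a (step i false)) k = (a i - 1 + k) * hgTerm a k := by
  have h0 : a i - 1 + k ≠ 0 := fun e => ha.1 i (1 - k) (by push_cast; linear_combination e)
  have e : Complex.Gamma (a i + k) = (a i - 1 + k) * Complex.Gamma (a i - 1 + k) := by
    rw [← Complex.Gamma_add_one _ h0]; congr 1; ring
  simp only [hgTerm, shift_step_false]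
  fin_cases i <;>
    simp only [Fin.zero_eta, Fin.mk_one, Fin.reduceFinMk, Fin.reduceEq, Fin.reduceLE, if_true,
      if_false] at hi e h0 ⊢ <;>
    rw [e] <;> field_simp

lemma hgf_up {a : Fin 5 → ℂ} (ha : Generic a) (hs : 1 < (saal a).re) (i : Fin 5) (hi : i < 3) :
    hgf (shift a (step i true)) 1 = a i * hgf a 1 + hgf (shift a 1) 1 := by
  have h := ((hasSum_hgTerm ha (by linarith)).mul_left (a i)).add (hasSum_hgTerm_mul ha hs)
  rw [hgf_one (shift a (step i true)), ← h.tsum_eq]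
  exact tsum_congr fun k => by rw [hgTerm_up ha i hi]; ring

lemma hgf_down {a : Fin 5 → ℂ} (ha : Generic a) (hs : 1 < (saal a).re) (i : Fin 5) (hi : 3 ≤ i) :
    hgf (shift a (step i false)) 1 = (a i - 1) * hgf a 1 + hgf (shift a 1) 1 := by
  have h := ((hasSum_hgTerm ha (by linarith)).mul_left (a i - 1)).add (hasSum_hgTerm_mul ha hs)
  rw [hgf_one (shift a (step i false)), ← h.tsum_eq]
  exact tsum_congr fun k => by rw [hgTerm_down ha i hi]; ring

/-- The coefficient `1 + φ₁ + φ₂ - a₃ a₄` of `f(a + 𝟏)` in the recurrence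
`(s(a) - 2) f(a + 2·𝟏) = φ₃(a) f(a) + ψ(a) f(a + 𝟏)` of the series `f`. -/
def psi {R : Type*} [CommRing R] (a : Fin 5 → R) : R :=
  1 + (a 0 + a 1 + a 2) + (a 0 * a 1 + a 1 * a 2 + a 2 * a 0) - a 3 * a 4

/-- The elementary symmetric polynomial `φ₃ = a₀ a₁ a₂`, the coefficient of `f(a)` in the same
recurrence. -/
def phiThree {R : Type*} [CommRing R] (a : Fin 5 → R) : R := a 0 * a 1 * a 2

lemma tendsto_natCast_cpow_zero {s : ℂ} (hs : s.re < 0) :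
    Tendsto (fun n : ℕ => (n : ℂ) ^ s) atTop (𝓝 0) := by
  rw [tendsto_zero_iff_norm_tendsto_zero]
  have h := (tendsto_rpow_neg_atTop (neg_pos.2 hs)).comp tendsto_natCast_atTop_atTop
  refine h.congr' ?_
  filter_upwards [eventually_gt_atTop 0] with n hn
  rw [Function.comp_apply, neg_neg, Complex.norm_natCast_cpow_of_pos hn]

lemma isEquivalent_natCast_add_const (x : ℂ) :
    (fun n : ℕ => (n : ℂ) + x) ~[atTop] fun n : ℕ => (n : ℂ) :=
  IsEquivalent.refl.add_const_of_norm_tendsto_atTop <|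
    tendsto_natCast_atTop_atTop.congr fun n => (Complex.norm_natCast n).symm

lemma tendsto_sum_recurrence {a : Fin 5 → ℂ} (ha : Generic a) (hs : 2 < (saal a).re) :
    Tendsto (fun k : ℕ => k * (a 3 + k - 1) * (a 4 + k - 1) * hgTerm a k) atTop (𝓝 0) := by
  rw [← tendsto_add_atTop_iff_nat 1]
  have h := (((isEquivalent_natCast_add_const 1).mul (isEquivalent_natCast_add_const (a 3))).mul
    (isEquivalent_natCast_add_const (a 4))).mul (isEquivalent_hgTerm ha)
  have h0 : Tendsto (fun n : ℕ => (n : ℂ) ^ (2 - saal a)) atTop (𝓝 0) :=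
    tendsto_natCast_cpow_zero (by simpa using hs)
  refine ((h.congr_right ?_).symm.tendsto_nhds h0).congr fun n => ?_
  · filter_upwards [eventually_ne_atTop 0] with n hn
    have hn0 : (n : ℂ) ≠ 0 := Nat.cast_ne_zero.2 hn
    simp only [Pi.mul_apply]
    rw [show 2 - saal a = -saal a - 1 + 3 by ring, Complex.cpow_add _ _ hn0, Complex.cpow_ofNat]
    ring
  · simp only [Pi.mul_apply]
    push_cast
    ring

lemma sum_range_recurrence {a : Fin 5 → ℂ} (ha : Generic a) (n : ℕ) :
    ∑ k ∈ Finset.range n, (phiThree a * hgTerm a k + psi a * (hgTerm a k * k) -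
      (saal a - 2) * (hgTerm a k * (k * (k - 1)))) =
      n * (a 3 + n - 1) * (a 4 + n - 1) * hgTerm a n := by
  induction n with
  | zero => simp
  | succ n ih =>
    rw [Finset.sum_range_succ, ih]
    simp only [phiThree, psi, saal]
    push_cast
    linear_combination -hgTerm_succ ha n

lemma hgf_recurrence {a : Fin 5 → ℂ} (ha : Generic a) (hs : 2 < (saal a).re) :
    (saal a - 2) * hgf (shift a 2) 1 = phiThree a * hgf a 1 + psi a * hgf (shift a 1) 1 := by
  have h := (((hasSum_hgTerm ha (by linarith)).mul_left (phiThree a)).add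
    ((hasSum_hgTerm_mul ha (by linarith)).mul_left (psi a))).sub
    ((hasSum_hgTerm_mul_sub_one ha hs).mul_left (saal a - 2))
  have h0 := h.tendsto_sum_nat
  simp only [sum_range_recurrence ha] at h0
  linear_combination -tendsto_nhds_unique h0 (tendsto_sum_recurrence ha hs)

lemma hgf_ofReal_ne_zero {x : Fin 5 → ℝ} (hx : Generic fun i => (x i : ℂ))
    (hs : 0 < (saal fun i => (x i : ℂ)).re) (hpos : ∀ i, 0 < x i) :
    hgf (fun i => (x i : ℂ)) 1 ≠ 0 := by
  set g : ℕ → ℝ := fun k => Real.Gamma (x 0 + k) * Real.Gamma (x 1 + k) * Real.Gamma (x 2 + k) /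
    (Real.Gamma (1 + k) * Real.Gamma (x 3 + k) * Real.Gamma (x 4 + k)) with hg
  have hterm k : hgTerm (fun i => (x i : ℂ)) k = (g k : ℂ) := by
    simp only [hgTerm, hg, Complex.ofReal_div, Complex.ofReal_mul, ← Complex.Gamma_ofReal]
    push_cast
    rfl
  have hG {y : ℝ} (hy : 0 < y) (k : ℕ) : 0 < Real.Gamma (y + k) :=
    Real.Gamma_pos_of_pos (by positivity)
  have hgpos k : 0 < g k :=
    div_pos (mul_pos (mul_pos (hG (hpos 0) k) (hG (hpos 1) k)) (hG (hpos 2) k))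
      (mul_pos (mul_pos (hG one_pos k) (hG (hpos 3) k)) (hG (hpos 4) k))
  have hsum : Summable g := by
    simpa only [funext hterm, Complex.summable_ofReal] using summable_hgTerm hx hs
  rw [hgf_one, tsum_congr hterm, ← Complex.ofReal_tsum, Complex.ofReal_ne_zero]
  exact (hsum.tsum_pos (fun k => (hgpos k).le) 0 (hgpos 0)).ne'

/-! ### Contiguity relations of the companions -/

/-- The projection `ℂ → ℂ / ℤ`. A vector is generic if its entries have distinct nonzero classes in
`ℂ / ℤ`, and modulo `ℤ` the involutions become linear. -/
def modInt : ℂ →+ ℂ ⧸ AddSubgroup.zmultiples (1 : ℂ) :=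
  QuotientAddGroup.mk' _

lemma modInt_eq_zero_iff {x : ℂ} : modInt x = 0 ↔ ∃ n : ℤ, x = n := by
  rw [modInt, QuotientAddGroup.mk'_apply, QuotientAddGroup.eq_zero_iff,
    AddSubgroup.mem_zmultiples_iff]
  simp only [zsmul_eq_mul, mul_one, eq_comm]

lemma modInt_one : modInt 1 = 0 := modInt_eq_zero_iff.2 ⟨1, Int.cast_one.symm⟩

lemma modInt_two : modInt 2 = 0 := modInt_eq_zero_iff.2 ⟨2, (Int.cast_ofNat 2).symm⟩

lemma generic_iff_modInt {a : Fin 5 → ℂ} : Generic a ↔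
    (∀ i, modInt (a i) ≠ 0) ∧ ∀ i j, i < j → modInt (a i) ≠ modInt (a j) := by
  have h (i j) : modInt (a i) = modInt (a j) ↔ ∃ n : ℤ, a i - a j = n := by
    rw [← modInt_eq_zero_iff, map_sub, sub_eq_zero]
  simp only [Generic, Ne, modInt_eq_zero_iff, h, not_exists]
  refine and_congr_right fun _ => ⟨fun H i j hij => H i j hij.ne, fun H i j hij n e => ?_⟩
  rcases lt_or_gt_of_ne hij with hij | hij
  · exact H i j hij n e
  · exact H j i hij (-n) (by push_cast; linear_combination -e)

lemma Generic.invol {a : Fin 5 → ℂ} (ha : Generic a) (ν : SingPt) (i : Fin 3) :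
    Generic (invol ν i a) := by
  rw [generic_iff_modInt] at ha ⊢
  obtain ⟨h, hlt⟩ := ha
  have h01 := hlt 0 1 (by decide)
  have h02 := hlt 0 2 (by decide)
  have h03 := hlt 0 3 (by decide)
  have h04 := hlt 0 4 (by decide)
  have h12 := hlt 1 2 (by decide)
  have h13 := hlt 1 3 (by decide)
  have h14 := hlt 1 4 (by decide)
  have h23 := hlt 2 3 (by decide)
  have h24 := hlt 2 4 (by decide)
  have h34 := hlt 3 4 (by decide)
  refine ⟨fun j => ?_, fun j k hjk => ?_⟩
  · cases ν <;> fin_cases i <;> fin_cases j <;>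
    simp [HypThreeTerm.invol, modInt_one, modInt_two, h, sub_eq_zero, h01, h02, h03, h04, h12, h13,
      h14, h23, h24, h34, h01.symm, h02.symm, h12.symm, h34.symm]
  · cases ν <;> fin_cases i <;> fin_cases j <;> fin_cases k <;>
    first
    | exact absurd hjk (by decide)
    | simp [HypThreeTerm.invol, modInt_one, modInt_two, h, h01, h02, h03, h04, h12, h13,
      h14, h23, h24, h34, h01.symm, h34.symm, sub_eq_neg_add, eq_comm (a := modInt _)]

lemma saal_invol (ν : SingPt) (i : Fin 3) (a : Fin 5 → ℂ) : saal (invol ν i a) = saal a := by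
  cases ν <;> fin_cases i <;> simp [invol, saal] <;> ring

lemma invol_invol (ν : SingPt) (i : Fin 3) (a : Fin 5 → ℂ) : invol ν i (invol ν i a) = a := by
  funext j
  cases ν <;> fin_cases i <;> fin_cases j <;> simp [invol] <;> ring

/-- The linear part of `invol`, acting on lattice vectors. -/
def involShift : SingPt → Fin 3 → (Fin 5 → ℤ) → (Fin 5 → ℤ)
  | .zero, 0, p => p
  | .zero, 1, p => ![p 0 - p 3, p 1 - p 3, p 2 - p 3, - p 3, p 4 - p 3]
  | .zero, 2, p => ![p 0 - p 4, p 1 - p 4, p 2 - p 4, p 3 - p 4, - p 4]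
  | .infty, 0, p => ![p 0, p 0 - p 3, p 0 - p 4, p 0 - p 1, p 0 - p 2]
  | .infty, 1, p => ![p 1 - p 3, p 1, p 1 - p 4, p 1 - p 0, p 1 - p 2]
  | .infty, 2, p => ![p 2 - p 4, p 2 - p 3, p 2, p 2 - p 1, p 2 - p 0]

lemma invol_shift (ν : SingPt) (i : Fin 3) (a : Fin 5 → ℂ) (p : Fin 5 → ℤ) :
    invol ν i (shift a p) = shift (invol ν i a) (involShift ν i p) := by
  funext j
  cases ν <;> fin_cases i <;> fin_cases j <;> simp [invol, shift, involShift] <;> ring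

/-- The six directions `𝟏, e₀, e₁, e₂, -e₃, -e₄`. These are the directions along which the
contiguity relations of the series are simplest, and every involution permutes them. -/
def dir : Fin 6 → Fin 5 → ℤ :=
  ![1, step 0 true, step 1 true, step 2 true, step 3 false, step 4 false]

/-- The coefficient of `f(a)` in the contiguity relation
`f(a + dir k) = dirCoeff a k * f(a) + f(a + 𝟏)`. -/
def dirCoeff {R : Type*} [CommRing R] (a : Fin 5 → R) : Fin 6 → R :=
  ![0, a 0, a 1, a 2, a 3 - 1, a 4 - 1]

/-- The permutation of the six directions `dir` induced by an involution. -/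
def dirPerm : SingPt → Fin 3 → Fin 6 → Fin 6
  | .zero, 0 => ![0, 1, 2, 3, 4, 5]
  | .zero, 1 => ![4, 1, 2, 3, 0, 5]
  | .zero, 2 => ![5, 1, 2, 3, 4, 0]
  | .infty, 0 => ![1, 0, 4, 5, 2, 3]
  | .infty, 1 => ![2, 4, 0, 5, 1, 3]
  | .infty, 2 => ![3, 5, 4, 0, 2, 1]

/-- The sign acquired by the prefactor `e^{iπ s(a)}` (or `1`) of a companion under a shift in one of
the directions `dir`, all of which have Saalschuetzian index `-1`. -/
def dirSign : SingPt → ℂ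
  | .zero => 1
  | .infty => -1

lemma dirSign_mul_self (ν : SingPt) : dirSign ν * dirSign ν = 1 := by
  cases ν <;> simp [dirSign]

lemma involShift_dir (ν : SingPt) (i : Fin 3) (k : Fin 6) :
    involShift ν i (dir k) = dir (dirPerm ν i k) := by
  cases ν <;> revert i k <;> decide

lemma dir_zero : dir 0 = 1 := rfl

lemma saal_dir (k : Fin 6) : saal (dir k) = -1 := by
  revert k; decide

lemma re_saal_shift_dir (a : Fin 5 → ℂ) (k : Fin 6) :
    (saal (shift a (dir k))).re = (saal a).re - 1 := by
  rw [re_saal_shift, saal_dir, Int.cast_neg, Int.cast_one, sub_eq_add_neg]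

/-- A function on parameter vectors that satisfies, wherever the series involved converge, the
contiguity relations of the series `a ↦ hgf a 1` in the six directions `dir` and its recurrence in
the direction `𝟏`. -/
structure IsContiguous (h : (Fin 5 → ℂ) → ℂ) : Prop where
  shift_dir : ∀ {a}, Generic a → 1 < (saal a).re → ∀ k,
    h (shift a (dir k)) = dirCoeff a k * h a + h (shift a 1)
  recurrence : ∀ {a}, Generic a → 2 < (saal a).re →
    (saal a - 2) * h (shift a 2) = phiThree a * h a + psi a * h (shift a 1)

lemma hgf_shift_dir {b : Fin 5 → ℂ} (hb : Generic b) (hs : 1 < (saal b).re) (k : Fin 6) :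
    hgf (shift b (dir k)) 1 = dirCoeff b k * hgf b 1 + hgf (shift b 1) 1 := by
  fin_cases k
  · simp [dir, dirCoeff]
  · exact hgf_up hb hs 0 (by decide)
  · exact hgf_up hb hs 1 (by decide)
  · exact hgf_up hb hs 2 (by decide)
  · exact hgf_down hb hs 3 (by decide)
  · exact hgf_down hb hs 4 (by decide)

lemma hgf_shift_dir_add_dir {b : Fin 5 → ℂ} (hb : Generic b) (hs : 2 < (saal b).re) (k : Fin 6) :
    hgf (shift b (dir k + dir k)) 1 =
      dirCoeff (shift b (dir k)) k * (dirCoeff b k * hgf b 1 + hgf (shift b 1) 1) +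
      (dirCoeff (shift b 1) k * hgf (shift b 1) 1 + hgf (shift b 2) 1) := by
  have hs1 : 1 < (saal b).re := by linarith
  calc hgf (shift b (dir k + dir k)) 1
      = dirCoeff (shift b (dir k)) k * hgf (shift b (dir k)) 1 + hgf (shift b (dir k + 1)) 1 := by
        rw [← shift_shift, ← shift_shift]
        exact hgf_shift_dir (hb.shift _) (by rw [re_saal_shift_dir]; linarith) k
    _ = dirCoeff (shift b (dir k)) k * (dirCoeff b k * hgf b 1 + hgf (shift b 1) 1) +
        (dirCoeff (shift b 1) k * hgf (shift b 1) 1 + hgf (shift b 2) 1) := by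
        rw [hgf_shift_dir hb hs1, add_comm (dir k), ← shift_shift,
          hgf_shift_dir (hb.shift 1) (by rw [re_saal_shift_one]; linarith), shift_one_shift_one]

/-- The prefactor `1` or `e^{iπ s(a)}` of a companion at the singular point `0` or `∞`. -/
noncomputable def compFactor : SingPt → (Fin 5 → ℂ) → ℂ
  | .zero, _ => 1
  | .infty, a => Complex.exp (Complex.I * Real.pi * saal a)

lemma companion_eq (ν : SingPt) (i : Fin 3) (a : Fin 5 → ℂ) :
    companion ν i a = compFactor ν a * hgf (invol ν i a) 1 := by
  cases ν <;> simp [companion, sol, compFactor]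

lemma compFactor_ne_zero (ν : SingPt) (a : Fin 5 → ℂ) : compFactor ν a ≠ 0 := by
  cases ν <;> simp [compFactor, Complex.exp_ne_zero]

lemma compFactor_shift_dir (ν : SingPt) (a : Fin 5 → ℂ) (k : Fin 6) :
    compFactor ν (shift a (dir k)) = dirSign ν * compFactor ν a := by
  cases ν
  · simp only [compFactor, dirSign, mul_one]
  · have h : Complex.I * Real.pi * saal (shift a (dir k)) =
        Complex.I * Real.pi * saal a - Real.pi * Complex.I := by
      rw [saal_shift, saal_dir]
      push_cast
      ring
    simp only [compFactor, dirSign, h, Complex.exp_sub, Complex.exp_pi_mul_I]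
    ring

lemma companion_shift_dir (ν : SingPt) (i : Fin 3) (a : Fin 5 → ℂ) (k : Fin 6) :
    companion ν i (shift a (dir k)) =
      dirSign ν * compFactor ν a * hgf (shift (invol ν i a) (dir (dirPerm ν i k))) 1 := by
  rw [companion_eq, compFactor_shift_dir, invol_shift, involShift_dir]

lemma companion_shift_one (ν : SingPt) (i : Fin 3) (a : Fin 5 → ℂ) :
    companion ν i (shift a 1) =
      dirSign ν * compFactor ν a * hgf (shift (invol ν i a) (dir (dirPerm ν i 0))) 1 :=
  companion_shift_dir ν i a 0

lemma companion_shift_two (ν : SingPt) (i : Fin 3) (a : Fin 5 → ℂ) :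
    companion ν i (shift a 2) = compFactor ν a *
      hgf (shift (invol ν i a) (dir (dirPerm ν i 0) + dir (dirPerm ν i 0))) 1 := by
  rw [← shift_one_shift_one, companion_shift_one, ← dir_zero, compFactor_shift_dir, invol_shift,
    involShift_dir, shift_shift, ← mul_assoc, dirSign_mul_self, one_mul]

lemma dirCoeff_invol (ν : SingPt) (i : Fin 3) (a : Fin 5 → ℂ) (k : Fin 6) :
    dirCoeff (invol ν i a) (dirPerm ν i k) =
      dirSign ν * dirCoeff a k + dirCoeff (invol ν i a) (dirPerm ν i 0) := by
  cases ν <;> fin_cases i <;> fin_cases k <;>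
    simp [dirCoeff, invol, dirPerm, dirSign] <;> ring

lemma hgf_invol_recurrence {a : Fin 5 → ℂ} (ha : Generic a) (hs : 2 < (saal a).re)
    (ν : SingPt) (i : Fin 3) :
    (saal a - 2) * hgf (shift (invol ν i a) (dir (dirPerm ν i 0) + dir (dirPerm ν i 0))) 1 =
      phiThree a * hgf (invol ν i a) 1 +
        psi a * (dirSign ν * hgf (shift (invol ν i a) (dir (dirPerm ν i 0))) 1) := by
  have hb := ha.invol ν i
  have hsb : 2 < (saal (invol ν i a)).re := by rwa [saal_invol]
  have hrec := hgf_recurrence hb hsb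
  rw [saal_invol] at hrec
  rw [hgf_shift_dir_add_dir hb hsb, hgf_shift_dir hb (by linarith)]
  generalize hgf (invol ν i a) 1 = f at *
  generalize hgf (shift (invol ν i a) 1) 1 = g at *
  generalize hgf (shift (invol ν i a) 2) 1 = w at *
  cases ν <;> fin_cases i <;>
    simp [dirCoeff, invol, dirPerm, dirSign, saal, phiThree, psi, shift, dir, step] at hrec ⊢ <;>
    linear_combination hrec

lemma isContiguous_companion (ν : SingPt) (i : Fin 3) : IsContiguous (companion ν i) where
  shift_dir {a} ha hs k := by
    have hb := ha.invol ν i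
    have hsb : 1 < (saal (invol ν i a)).re := by rwa [saal_invol]
    rw [companion_shift_dir, companion_shift_one, companion_eq, hgf_shift_dir hb hsb,
      hgf_shift_dir hb hsb, dirCoeff_invol]
    linear_combination dirCoeff a k * compFactor ν a * hgf (invol ν i a) 1 * dirSign_mul_self ν
  recurrence {a} ha hs := by
    rw [companion_shift_two, companion_shift_one, companion_eq]
    linear_combination compFactor ν a * hgf_invol_recurrence ha hs ν i

/-! ### Connection matrices and their determinants -/

section Connection

variable {F E : Type*} [Field F] [Field E]

lemma connMat_add {a : Fin 5 → F} (ha : Regular a) (p q : Fin 5 → ℤ) :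
    connMat a (p + q) = connMat (shift a p) q * connMat a p := by
  rw [← pathMat_eq_connMat ha (w := axisPath p ++ axisPath q)
    (by rw [endPt_append, endPt_axisPath, endPt_axisPath]), pathMat_append, endPt_axisPath]
  rfl

lemma saal_map {R S : Type*} [CommRing R] [CommRing S] (f : R →+* S) (a : Fin 5 → R) :
    saal (f ∘ a) = f (saal a) := by
  simp only [saal, Function.comp_apply, map_sub, map_add]

lemma psi_map {R S : Type*} [CommRing R] [CommRing S] (f : R →+* S) (a : Fin 5 → R) :
    psi (f ∘ a) = f (psi a) := by
  simp only [psi, Function.comp_apply, map_sub, map_add, map_mul, map_one]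

lemma phiThree_map {R S : Type*} [CommRing R] [CommRing S] (f : R →+* S) (a : Fin 5 → R) :
    phiThree (f ∘ a) = f (phiThree a) := by
  simp only [phiThree, Function.comp_apply, map_mul]

lemma shift_map {R S : Type*} [CommRing R] [CommRing S] (f : R →+* S) (a : Fin 5 → R)
    (p : Fin 5 → ℤ) : shift (f ∘ a) p = f ∘ shift a p := by
  funext i
  simp only [shift, Function.comp_apply, map_add, map_intCast]

lemma contig_map (f : F →+* E) (a : Fin 5 → F) (i : Fin 5) (ε : Bool) :
    contig (f ∘ a) i ε = (contig a i ε).map f := by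
  ext r k
  cases ε <;> fin_cases i <;> fin_cases r <;> fin_cases k <;>
    simp [contig, numUp, numDown, denUp, denDown, map_ofNat f 2]

lemma pathMat_map (f : F →+* E) (a : Fin 5 → F) (w : List (Fin 5 × Bool)) :
    pathMat (f ∘ a) w = (pathMat a w).map f := by
  induction w generalizing a with
  | nil => exact (Matrix.map_one f f.map_zero f.map_one).symm
  | cons e w ih => rw [pathMat, pathMat, shift_map, ih, contig_map, Matrix.map_mul]

lemma connMat_map (f : F →+* E) (a : Fin 5 → F) (p : Fin 5 → ℤ) :
    connMat (f ∘ a) p = (connMat a p).map f :=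
  pathMat_map f a _

lemma Regular.sub_add_ne_zero {a : Fin 5 → F} (ha : Regular a) {i j : Fin 5} (hij : i ≠ j)
    (n : ℤ) : a i - a j + n ≠ 0 :=
  fun e => ha.1.2 i j hij (-n) (by push_cast; linear_combination e)

lemma Regular.apply_add_ne_zero {a : Fin 5 → F} (ha : Regular a) (i : Fin 5) (n : ℤ) :
    a i + n ≠ 0 :=
  fun e => ha.1.1 i (-n) (by push_cast; linear_combination e)

lemma Regular.saal_add_ne_zero {a : Fin 5 → F} (ha : Regular a) (n : ℤ) : saal a + n ≠ 0 :=
  fun e => ha.2 (-n) (by push_cast; linear_combination e)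

lemma Regular.saal_sub_two_ne_zero {a : Fin 5 → F} (ha : Regular a) : saal a - 2 ≠ 0 := by
  simpa [sub_eq_add_neg] using ha.saal_add_ne_zero (-2)

lemma Regular.saal_sub_one_add_ne_zero {a : Fin 5 → F} (ha : Regular a) (n : ℤ) :
    saal a - 1 + n ≠ 0 := by
  simpa [sub_eq_add_neg, add_assoc] using ha.saal_add_ne_zero (-1 + n)

lemma poch_zero (x : F) : poch x 0 = 1 :=
  Finset.prod_range_zero _

lemma poch_one (x : F) : poch x 1 = x := by
  simp [poch]

lemma poch_neg_one (x : F) : poch x (-1) = (x - 1)⁻¹ := by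
  change (∏ k ∈ Finset.range (0 + 1), (x - ((k : F) + 1)))⁻¹ = _
  simp

lemma poch_add_one {x : F} (hx : ∀ n : ℤ, x + n ≠ 0) (n : ℤ) :
    poch x (n + 1) = poch x n * (x + n) := by
  rcases n with m | m | m
  · rw [show Int.ofNat m + 1 = Int.ofNat (m + 1) from rfl, poch, poch, Finset.prod_range_succ]
    simp
  · have h : x - 1 ≠ 0 := by simpa [sub_eq_add_neg] using hx (-1)
    rw [show Int.negSucc 0 = -1 from rfl, neg_add_cancel, poch_zero, poch_neg_one]
    simp [← sub_eq_add_neg, h]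
  · have e : x + (Int.negSucc (m + 1) : ℤ) = x - (((m + 1 : ℕ) : F) + 1) := by
      rw [Int.negSucc_eq]
      push_cast
      ring
    have h := hx (Int.negSucc (m + 1))
    rw [e] at h
    rw [show Int.negSucc (m + 1) + 1 = Int.negSucc m from rfl, poch, poch, e,
      Finset.prod_range_succ _ (m + 1), mul_inv, mul_assoc, inv_mul_cancel₀ h, mul_one]

lemma poch_add {x : F} (hx : ∀ n : ℤ, x + n ≠ 0) (m n : ℤ) :
    poch x (m + n) = poch x m * poch (x + m) n := by
  have hm (k : ℤ) : x + m + k ≠ 0 := by simpa [add_assoc] using hx (m + k)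
  induction n with
  | zero => rw [add_zero, poch_zero, mul_one]
  | succ n ih =>
    rw [← add_assoc, poch_add_one hx, ih, poch_add_one hm]
    push_cast
    ring
  | pred n ih =>
    have e1 := poch_add_one hx (m + (-(n : ℤ) - 1))
    have e2 := poch_add_one hm (-(n : ℤ) - 1)
    rw [show m + (-(n : ℤ) - 1) + 1 = m + -n by ring, ih] at e1
    rw [show (-(n : ℤ) - 1) + 1 = -n by ring] at e2
    rw [e2] at e1
    have h0 := hm (-(n : ℤ) - 1)
    push_cast at e1 h0
    exact mul_right_cancel₀ h0 (by linear_combination -e1)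

lemma prod_poch_add {ι : Type*} {s : Finset ι} {x : ι → F}
    (hx : ∀ i ∈ s, ∀ n : ℤ, x i + n ≠ 0) (m n : ι → ℤ) :
    ∏ i ∈ s, poch (x i) (m i + n i) =
      (∏ i ∈ s, poch (x i) (m i)) * ∏ i ∈ s, poch (x i + m i) (n i) := by
  rw [← Finset.prod_mul_distrib]
  exact Finset.prod_congr rfl fun i hi => poch_add (hx i hi) _ _

lemma smallDelta_add {a : Fin 5 → F} (ha : Regular a) (p q : Fin 5 → ℤ) :
    smallDelta a (p + q) = smallDelta a p * smallDelta (shift a p) q := by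
  have hsign : (-1 : F) ^ (p 0 + q 0 + (p 1 + q 1) + (p 2 + q 2)) =
      (-1) ^ (p 0 + p 1 + p 2) * (-1) ^ (q 0 + q 1 + q 2) := by
    rw [← zpow_add₀ (neg_ne_zero.2 one_ne_zero)]
    congr 1
    ring
  have hsaal : saal (shift a p) - 1 = saal a - 1 + (saal p : ℤ) := by rw [saal_shift]; ring
  have hdiff (i j) : shift a p i - shift a p j = a i - a j + ((p i - p j : ℤ) : F) := by
    simp only [shift]
    push_cast
    ring
  have hnum := prod_poch_add (s := {0, 1, 2}) (fun i _ => ha.apply_add_ne_zero i) p q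
  have hden := prod_poch_add (s := ({0, 1, 2} : Finset (Fin 5)) ×ˢ ({3, 4} : Finset (Fin 5)))
    (x := fun ij => a ij.2 - a ij.1)
    (fun ij hij => ha.sub_add_ne_zero (by
      rintro h
      rw [Finset.mem_product, h] at hij
      exact absurd hij (by generalize ij.1 = i; revert i; decide)))
    (fun ij => p ij.2 - p ij.1) (fun ij => q ij.2 - q ij.1)
  simp only [Finset.prod_product, ← add_sub_add_comm] at hden
  simp only [smallDelta, hsign, saal_add, hsaal, poch_add ha.saal_sub_one_add_ne_zero, hdiff,
    Pi.add_apply, hnum, hden]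
  simp only [shift]
  ring

lemma smallDelta_zero (a : Fin 5 → F) : smallDelta a 0 = 1 := by
  simp [smallDelta, poch_zero, saal]

lemma det_contig_up {a : Fin 5 → F} (ha : Regular a) (i : Fin 5) :
    (contig a i true).det = smallDelta a (step i true) := by
  have hs1 : a 3 + a 4 - a 0 - a 1 - a 2 - 1 ≠ 0 := by
    simpa [saal] using ha.saal_sub_one_add_ne_zero 0
  have hs2 : a 3 + a 4 - a 0 - a 1 - a 2 - 1 - 1 ≠ 0 := by
    simpa [saal, sub_eq_add_neg] using ha.saal_sub_one_add_ne_zero (-1)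
  have hd {i j : Fin 5} (hij : i ≠ j) : a i - a j ≠ 0 := by
    simpa using ha.sub_add_ne_zero hij 0
  have d30 : a 3 - a 0 ≠ 0 := hd (by decide)
  have d31 : a 3 - a 1 ≠ 0 := hd (by decide)
  have d32 : a 3 - a 2 ≠ 0 := hd (by decide)
  have d40 : a 4 - a 0 ≠ 0 := hd (by decide)
  have d41 : a 4 - a 1 ≠ 0 := hd (by decide)
  have d42 : a 4 - a 2 ≠ 0 := hd (by decide)
  have q0 : a 3 + a 4 - a 0 - a 1 - a 2 - 2 ≠ 0 := fun e => hs2 (by linear_combination e)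
  have q1 : a 3 + a 4 - a 1 - a 2 - a 0 - 2 ≠ 0 := fun e => hs2 (by linear_combination e)
  have q2 : a 3 + a 4 - a 2 - a 0 - a 1 - 2 ≠ 0 := fun e => hs2 (by linear_combination e)
  fin_cases i <;>
  simp [smallDelta, saal, step, poch_zero, poch_one, poch_neg_one, contig, numUp, denUp,
    Matrix.det_fin_two] <;>
  field_simp <;> ring

lemma det_contig {a : Fin 5 → F} (ha : Regular a) (i : Fin 5) (ε : Bool) :
    (contig a i ε).det = smallDelta a (step i ε) := by
  cases ε
  · have hdet := congrArg Matrix.det (contig_inv ha i false)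
    have hdelta := smallDelta_add ha (step i false) (step i true)
    rw [show step i false + step i true = 0 from step_not i false, smallDelta_zero] at hdelta
    rw [Matrix.det_mul, Matrix.det_one, Bool.not_false, det_contig_up (ha.shift _)] at hdet
    exact mul_left_cancel₀ (left_ne_zero_of_mul_eq_one hdet) (by rw [hdet, hdelta, mul_comm])
  · exact det_contig_up ha i

lemma det_pathMat {a : Fin 5 → F} (ha : Regular a) (w : List (Fin 5 × Bool)) :
    (pathMat a w).det = smallDelta a (endPt w) := by
  induction w generalizing a with
  | nil => rw [pathMat, endPt, Matrix.det_one, smallDelta_zero]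
  | cons e w ih =>
    rw [pathMat, Matrix.det_mul, ih (ha.shift _), det_contig ha, endPt, smallDelta_add ha, mul_comm]

lemma det_connMat {a : Fin 5 → F} (ha : Regular a) (p : Fin 5 → ℤ) :
    (connMat a p).det = smallDelta a p := by
  rw [connMat, det_pathMat ha, endPt_axisPath]

lemma smallDelta_ne_zero {a : Fin 5 → F} (ha : Regular a) (p : Fin 5 → ℤ) :
    smallDelta a p ≠ 0 := by
  have h := smallDelta_add ha p (-p)
  rw [add_neg_cancel, smallDelta_zero] at h
  exact left_ne_zero_of_mul_eq_one h.symm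

lemma isUnit_connMat {a : Fin 5 → F} (ha : Regular a) (p : Fin 5 → ℤ) : IsUnit (connMat a p) := by
  rw [Matrix.isUnit_iff_isUnit_det, det_connMat ha]
  exact (smallDelta_ne_zero ha p).isUnit

lemma bigDelta_eq {a : Fin 5 → F} (ha : Regular a) (p q : Fin 5 → ℤ) :
    bigDelta a p q = smallDelta a p * rTwo (shift a p) (q - p) := by
  have h := connMat_add ha p (q - p)
  rw [add_sub_cancel] at h
  simp only [← det_connMat ha, bigDelta, rOne, rTwo, h, Matrix.det_fin_two, Matrix.mul_apply,
    Fin.sum_univ_two, Matrix.of_apply, Matrix.cons_val', Matrix.cons_val_zero, Matrix.cons_val_one]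
  ring

/-- The closed form of the connection matrix `A(a; 𝟏)`, the companion matrix of the recurrence
in the direction `𝟏`. -/
def oneMat (a : Fin 5 → F) : Matrix (Fin 2) (Fin 2) F :=
  !![0, 1; phiThree a / (saal a - 2), psi a / (saal a - 2)]

lemma numUp_mul_eq_denDown_mul {x y z b c : F} (h2 : b + c - x - y - z - 2 ≠ 0)
    (h3 : b + c - x - y - z - 3 ≠ 0) (h4 : b + c - x - y - z - 4 ≠ 0) :
    numUp z (x + 1) (y + 1) b c * (numUp y z (x + 1) b c * numUp x y z b c) =
      denDown (c + 1) b (x + 1) (y + 1) (z + 1) *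
        (denDown (b + 1) (c + 1) (x + 1) (y + 1) (z + 1) *
          !![0, 1; x * y * z / (b + c - x - y - z - 2),
            (1 + (x + y + z) + (x * y + y * z + z * x) - b * c) / (b + c - x - y - z - 2)]) := by
  obtain ⟨s, rfl⟩ : ∃ s, c = s + x + y + z - b := ⟨b + c - x - y - z, by ring⟩
  have e2 : b + (s + x + y + z - b) - x - y - z - 2 = s - 2 := by ring
  have e3 : b + (s + x + y + z - b) - y - z - (x + 1) - 2 = s - 3 := by ring
  have e4 : b + (s + x + y + z - b) - z - (x + 1) - (y + 1) - 2 = s - 4 := by ring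
  have f4 : s + x + y + z - b + 1 + b - (x + 1) - (y + 1) - (z + 1) - 2 = s - 4 := by ring
  have f3 : b + 1 + (s + x + y + z - b + 1) - (x + 1) - (y + 1) - (z + 1) - 2 = s - 3 := by ring
  have h2' : s - 2 ≠ 0 := by rwa [e2] at h2
  have h3' : s - 3 ≠ 0 := fun e => h3 (by linear_combination e)
  have h4' : s - 4 ≠ 0 := fun e => h4 (by linear_combination e)
  simp only [numUp, denDown, e2, e3, e4, f3, f4, Matrix.mul_fin_two]
  congr 1
  funext r k
  fin_cases r <;> fin_cases k <;>
    simp only [Fin.mk_zero, Fin.mk_one, Matrix.cons_val_zero, Matrix.cons_val_one] <;>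
    field_simp <;> ring

lemma connMat_one {a : Fin 5 → F} (ha : Regular a) : connMat a 1 = oneMat a := by
  -- `e₀ + e₁ + e₂ = 𝟏 - e₃ - e₄` gives two paths with the same end point.
  have hs (n : ℤ) : a 3 + a 4 - a 0 - a 1 - a 2 ≠ n := ha.2 n
  have hmul := numUp_mul_eq_denDown_mul (x := a 0) (y := a 1) (z := a 2) (b := a 3) (c := a 4)
    (fun e => hs 2 (by push_cast; linear_combination e))
    (fun e => hs 3 (by push_cast; linear_combination e))
    (fun e => hs 4 (by push_cast; linear_combination e))
  set p := endPt [((0 : Fin 5), true), (1, true), (2, true)] with hp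
  set q := endPt [((3 : Fin 5), false), (4, false)] with hq
  have hup : _ = connMat a p :=
    pathMat_eq_connMat ha (w := [((0 : Fin 5), true), (1, true), (2, true)]) rfl
  have hdown : _ = connMat (shift a 1) q :=
    pathMat_eq_connMat (ha.shift 1) (w := [((3 : Fin 5), false), (4, false)]) rfl
  have hone (j) : shift a 1 j = a j + 1 := by simp [shift]
  simp only [pathMat, one_mul, contig, shift_step, shift_step_false, hone, Fin.reduceEq, if_false,
    if_true, add_sub_cancel_right] at hup hdown
  have hpq : p = 1 + q := by rw [hp, hq]; decide
  rw [mul_assoc, hmul, ← mul_assoc, hdown, hpq, connMat_add ha] at hup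
  exact (isUnit_connMat (ha.shift 1) q).mul_left_cancel hup.symm

lemma connMat_mul_oneMat {a : Fin 5 → F} (ha : Regular a) (p : Fin 5 → ℤ) :
    connMat (shift a 1) p * oneMat a = oneMat (shift a p) * connMat a p := by
  rw [← connMat_one ha, ← connMat_one (ha.shift p), ← connMat_add ha, ← connMat_add ha, add_comm]

lemma connMat_row_one {a : Fin 5 → F} (ha : Regular a) (p : Fin 5 → ℤ) :
    connMat a p 1 = Matrix.vecMul (connMat (shift a 1) p 0) (oneMat a) := by
  rw [← Matrix.mul_apply_eq_vecMul, connMat_mul_oneMat ha]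
  funext k
  simp [Matrix.mul_apply, oneMat]

end Connection

/-! ### Values of fractions -/

section Values

variable {R K L : Type*} [CommRing R] [Field K] [Algebra R K] [Field L]

/-- The element `u` of the fraction field of `R` has a representative without pole at `φ`, and its
value there is `c`. -/
def HasValue (φ : R →+* L) (u : K) (c : L) : Prop :=
  ∃ P Q : R, φ Q ≠ 0 ∧ u = algebraMap R K P / algebraMap R K Q ∧ c = φ P / φ Q

variable {φ : R →+* L} {u v : K} {c d : L}

lemma hasValue_algebraMap (P : R) : HasValue φ (algebraMap R K P) (φ P) :=
  ⟨P, 1, by simp, by simp, by simp⟩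

lemma HasValue.neg (hu : HasValue φ u c) : HasValue φ (-u) (-c) := by
  obtain ⟨P, Q, hQ, rfl, rfl⟩ := hu
  exact ⟨-P, Q, hQ, by simp [neg_div], by simp [neg_div]⟩

lemma HasValue.mul (hu : HasValue φ u c) (hv : HasValue φ v d) : HasValue φ (u * v) (c * d) := by
  obtain ⟨P, Q, hQ, rfl, rfl⟩ := hu
  obtain ⟨P', Q', hQ', rfl, rfl⟩ := hv
  exact ⟨P * P', Q * Q', by simp [hQ, hQ'], by simp [div_mul_div_comm], by simp [div_mul_div_comm]⟩

lemma HasValue.inv (hu : HasValue φ u c) (hc : c ≠ 0) : HasValue φ u⁻¹ c⁻¹ := by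
  obtain ⟨P, Q, -, rfl, rfl⟩ := hu
  exact ⟨Q, P, fun h => hc (by simp [h]), by simp, by simp⟩

lemma HasValue.div (hu : HasValue φ u c) (hv : HasValue φ v d) (hd : d ≠ 0) :
    HasValue φ (u / v) (c / d) := by
  rw [div_eq_mul_inv, div_eq_mul_inv]
  exact hu.mul (hv.inv hd)

lemma HasValue.pow (hu : HasValue φ u c) (n : ℕ) : HasValue φ (u ^ n) (c ^ n) := by
  obtain ⟨P, Q, hQ, rfl, rfl⟩ := hu
  exact ⟨P ^ n, Q ^ n, by simp [hQ], by simp [div_pow], by simp [div_pow]⟩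

lemma hasValue_intCast (n : ℤ) : HasValue φ (n : K) n := by
  simpa using hasValue_algebraMap (K := K) (φ := φ) (n : R)

lemma hasValue_one : HasValue φ (1 : K) 1 := by
  simpa using hasValue_intCast (K := K) (φ := φ) 1

lemma hasValue_zero : HasValue φ (0 : K) 0 := by
  simpa using hasValue_intCast (K := K) (φ := φ) 0

lemma hasValue_two : HasValue φ (2 : K) 2 := by
  simpa using hasValue_intCast (K := K) (φ := φ) 2

lemma hasValue_matrix_one (r k : Fin 2) :
    HasValue φ ((1 : Matrix (Fin 2) (Fin 2) K) r k) ((1 : Matrix (Fin 2) (Fin 2) L) r k) := by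
  rw [Matrix.one_apply, Matrix.one_apply]
  split_ifs
  exacts [hasValue_one, hasValue_zero]

variable {x : Fin 5 → K} {b : Fin 5 → L}

lemma hasValue_phiThree (hx : ∀ i, HasValue φ (x i) (b i)) :
    HasValue φ (phiThree x) (phiThree b) :=
  ((hx 0).mul (hx 1)).mul (hx 2)

variable [IsFractionRing R K]

lemma algebraMap_ne_zero_of_map_ne_zero {Q : R} (h : φ Q ≠ 0) : algebraMap R K Q ≠ 0 := by
  rw [Ne, IsFractionRing.to_map_eq_zero_iff]
  rintro rfl
  exact h φ.map_zero

lemma HasValue.unique (hu : HasValue φ u c) (hv : HasValue φ u d) : c = d := by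
  obtain ⟨P, Q, hQ, rfl, rfl⟩ := hu
  obtain ⟨P', Q', hQ', e, rfl⟩ := hv
  rw [div_eq_div_iff (algebraMap_ne_zero_of_map_ne_zero hQ) (algebraMap_ne_zero_of_map_ne_zero hQ'),
    ← map_mul, ← map_mul] at e
  rw [div_eq_div_iff hQ hQ', ← map_mul, ← map_mul, IsFractionRing.injective R K e]

lemma HasValue.add (hu : HasValue φ u c) (hv : HasValue φ v d) : HasValue φ (u + v) (c + d) := by
  obtain ⟨P, Q, hQ, rfl, rfl⟩ := hu
  obtain ⟨P', Q', hQ', rfl, rfl⟩ := hv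
  have h1 : algebraMap R K Q ≠ 0 := algebraMap_ne_zero_of_map_ne_zero hQ
  have h2 : algebraMap R K Q' ≠ 0 := algebraMap_ne_zero_of_map_ne_zero hQ'
  exact ⟨P * Q' + Q * P', Q * Q', by simp [hQ, hQ'], by simp [div_add_div _ _ h1 h2],
    by simp [div_add_div _ _ hQ hQ']⟩

lemma HasValue.sub (hu : HasValue φ u c) (hv : HasValue φ v d) : HasValue φ (u - v) (c - d) := by
  rw [sub_eq_add_neg, sub_eq_add_neg]
  exact hu.add hv.neg

lemma hasValue_shift (hx : ∀ i, HasValue φ (x i) (b i)) (p : Fin 5 → ℤ) (i : Fin 5) :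
    HasValue φ (shift x p i) (shift b p i) :=
  (hx i).add (hasValue_intCast _)

lemma hasValue_saal (hx : ∀ i, HasValue φ (x i) (b i)) : HasValue φ (saal x) (saal b) :=
  ((((hx 3).add (hx 4)).sub (hx 0)).sub (hx 1)).sub (hx 2)

lemma hasValue_psi (hx : ∀ i, HasValue φ (x i) (b i)) : HasValue φ (psi x) (psi b) :=
  ((hasValue_one.add (((hx 0).add (hx 1)).add (hx 2))).add
    ((((hx 0).mul (hx 1)).add ((hx 1).mul (hx 2))).add ((hx 2).mul (hx 0)))).sub
    ((hx 3).mul (hx 4))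

section Entries

variable {x y z b c : K} {x' y' z' b' c' : L}

lemma hasValue_numUp (hx : HasValue φ x x') (hy : HasValue φ y y') (hz : HasValue φ z z')
    (hb : HasValue φ b b') (hc : HasValue φ c c') (h : b' + c' - x' - y' - z' - 2 ≠ 0)
    (r k : Fin 2) : HasValue φ (numUp x y z b c r k) (numUp x' y' z' b' c' r k) := by
  have h1 := hasValue_one (K := K) (φ := φ)
  have hs := ((((hb.add hc).sub hx).sub hy).sub hz).sub (hasValue_two (φ := φ))
  fin_cases r <;> fin_cases k
  · exact hx
  · exact h1
  · exact ((hx.mul hy).mul hz).div hs h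
  · exact ((hy.mul hz).sub (((hx.sub hb).add h1).mul ((hx.sub hc).add h1))).div hs h

lemma hasValue_numDown (hx : HasValue φ x x') (hy : HasValue φ y y') (hz : HasValue φ z z')
    (hb : HasValue φ b b') (hc : HasValue φ c c') (h1 : x' - 1 ≠ 0) (h2 : x' - b' ≠ 0)
    (h3 : x' - c' ≠ 0) (r k : Fin 2) :
    HasValue φ (numDown x y z b c r k) (numDown x' y' z' b' c' r k) := by
  have h := hasValue_one (K := K) (φ := φ)
  have hs := ((((hb.add hc).sub hx).sub hy).sub hz).sub h
  have hd := (hx.sub hb).mul (hx.sub hc)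
  have hd0 := mul_ne_zero h2 h3
  have he := ((hx.sub h).mul (hx.sub hb)).mul (hx.sub hc)
  have he0 := mul_ne_zero (mul_ne_zero h1 h2) h3
  fin_cases r <;> fin_cases k
  · exact (hd.sub (hy.mul hz)).div he he0
  · exact hs.div he he0
  · exact (hy.mul hz).div hd hd0
  · exact (hs.div hd hd0).neg

lemma hasValue_denUp (hb : HasValue φ b b') (hc : HasValue φ c c') (hx : HasValue φ x x')
    (hy : HasValue φ y y') (hz : HasValue φ z z') (h1 : b' - x' ≠ 0) (h2 : b' - y' ≠ 0)
    (h3 : b' - z' ≠ 0) (r k : Fin 2) :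
    HasValue φ (denUp b c x y z r k) (denUp b' c' x' y' z' r k) := by
  have hs := ((((hb.add hc).sub hx).sub hy).sub hz).sub (hasValue_one (φ := φ))
  have hd := ((hb.sub hx).mul (hb.sub hy)).mul (hb.sub hz)
  have hd0 := mul_ne_zero (mul_ne_zero h1 h2) h3
  fin_cases r <;> fin_cases k
  · exact (((hb.pow 2).sub (((hx.add hy).add hz).mul hb)).add
      (((hx.mul hy).add (hy.mul hz)).add (hz.mul hx))).div hd hd0
  · exact (hs.div hd hd0).neg
  · exact (((hx.mul hy).mul hz).div hd hd0).neg
  · exact (hb.mul hs).div hd hd0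

lemma hasValue_denDown (hb : HasValue φ b b') (hc : HasValue φ c c') (hx : HasValue φ x x')
    (hy : HasValue φ y y') (hz : HasValue φ z z') (h : b' + c' - x' - y' - z' - 2 ≠ 0)
    (r k : Fin 2) : HasValue φ (denDown b c x y z r k) (denDown b' c' x' y' z' r k) := by
  have h1 := hasValue_one (K := K) (φ := φ)
  have hs := ((((hb.add hc).sub hx).sub hy).sub hz).sub (hasValue_two (φ := φ))
  fin_cases r <;> fin_cases k
  · exact hb.sub h1
  · exact h1
  · exact ((hx.mul hy).mul hz).div hs h
  · exact ((((hb.sub h1).pow 2).sub (((hx.add hy).add hz).mul (hb.sub h1))).add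
      (((hx.mul hy).add (hy.mul hz)).add (hz.mul hx))).div hs h

end Entries

lemma hasValue_contig (hx : ∀ i, HasValue φ (x i) (b i)) (hb : Generic b) (i : Fin 5) (ε : Bool)
    (hs : saal (step i ε) = -1 → saal b ≠ 2) (r k : Fin 2) :
    HasValue φ (contig x i ε r k) (contig b i ε r k) := by
  have hd : ∀ i j : Fin 5, i ≠ j → b i - b j ≠ 0 := fun i j hij => by
    simpa using hb.2 i j hij 0
  have h1 : ∀ i, b i - 1 ≠ 0 := fun i e => hb.1 i 1 (by push_cast; linear_combination e)
  cases ε <;> fin_cases i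
  · exact hasValue_numDown (hx 0) (hx 1) (hx 2) (hx 3) (hx 4) (h1 _) (hd _ _ (by decide))
      (hd _ _ (by decide)) r k
  · exact hasValue_numDown (hx 1) (hx 2) (hx 0) (hx 3) (hx 4) (h1 _) (hd _ _ (by decide))
      (hd _ _ (by decide)) r k
  · exact hasValue_numDown (hx 2) (hx 0) (hx 1) (hx 3) (hx 4) (h1 _) (hd _ _ (by decide))
      (hd _ _ (by decide)) r k
  · exact hasValue_denDown (hx 3) (hx 4) (hx 0) (hx 1) (hx 2)
      (fun e => hs (by decide) (by simp only [saal]; linear_combination e)) r k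
  · exact hasValue_denDown (hx 4) (hx 3) (hx 0) (hx 1) (hx 2)
      (fun e => hs (by decide) (by simp only [saal]; linear_combination e)) r k
  · exact hasValue_numUp (hx 0) (hx 1) (hx 2) (hx 3) (hx 4)
      (fun e => hs (by decide) (by simp only [saal]; linear_combination e)) r k
  · exact hasValue_numUp (hx 1) (hx 2) (hx 0) (hx 3) (hx 4)
      (fun e => hs (by decide) (by simp only [saal]; linear_combination e)) r k
  · exact hasValue_numUp (hx 2) (hx 0) (hx 1) (hx 3) (hx 4)
      (fun e => hs (by decide) (by simp only [saal]; linear_combination e)) r k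
  · exact hasValue_denUp (hx 3) (hx 4) (hx 0) (hx 1) (hx 2) (hd _ _ (by decide))
      (hd _ _ (by decide)) (hd _ _ (by decide)) r k
  · exact hasValue_denUp (hx 4) (hx 3) (hx 0) (hx 1) (hx 2) (hd _ _ (by decide))
      (hd _ _ (by decide)) (hd _ _ (by decide)) r k

lemma hasValue_matrix_mul {M N : Matrix (Fin 2) (Fin 2) K} {M' N' : Matrix (Fin 2) (Fin 2) L}
    (hM : ∀ r k, HasValue φ (M r k) (M' r k)) (hN : ∀ r k, HasValue φ (N r k) (N' r k))
    (r k : Fin 2) : HasValue φ ((M * N) r k) ((M' * N') r k) := by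
  rw [Matrix.mul_apply, Matrix.mul_apply, Fin.sum_univ_two, Fin.sum_univ_two]
  exact ((hM r 0).mul (hN 0 k)).add ((hM r 1).mul (hN 1 k))

lemma hasValue_pathMat (w : List (Fin 5 × Bool)) {x : Fin 5 → K} {b : Fin 5 → L}
    (hx : ∀ i, HasValue φ (x i) (b i)) (hb : Regular b) (r k : Fin 2) :
    HasValue φ (pathMat x w r k) (pathMat b w r k) := by
  induction w generalizing x b r k with
  | nil => exact hasValue_matrix_one r k
  | cons e w ih =>
    exact hasValue_matrix_mul (ih (hasValue_shift hx _) (hb.shift _))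
      (hasValue_contig hx hb.1 e.1 e.2 fun _ => by simpa using hb.2 2) r k

end Values

/-! ### Transport along lattice paths -/

lemma step_decide (i : Fin 5) : step i (decide (i < 3)) = dir i.succ := by
  revert i; decide

lemma saal_step (i : Fin 5) (ε : Bool) :
    saal (step i ε) = if ε = decide (i < 3) then -1 else 1 := by
  revert i ε; decide

lemma contig_decide {F : Type*} [Field F] {a : Fin 5 → F} (hs : saal a - 2 ≠ 0) (i : Fin 5) :
    contig a i (decide (i < 3)) = !![dirCoeff a i.succ, 1;
      phiThree a / (saal a - 2), dirCoeff (shift a 1) i.succ + psi a / (saal a - 2)] := by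
  have hsum (c : F) (hc : c = saal a - 2) : c ≠ 0 := hc ▸ hs
  have h0 := hsum (a 3 + a 4 - a 0 - a 1 - a 2 - 2) (by simp only [saal])
  have h1 := hsum (a 3 + a 4 - a 1 - a 2 - a 0 - 2) (by simp only [saal]; ring)
  have h2 := hsum (a 3 + a 4 - a 2 - a 0 - a 1 - 2) (by simp only [saal]; ring)
  have h4 := hsum (a 4 + a 3 - a 0 - a 1 - a 2 - 2) (by simp only [saal]; ring)
  ext r k
  fin_cases i <;> fin_cases r <;> fin_cases k <;>
    simp [dirCoeff, contig, numUp, denDown, saal, phiThree, psi, shift] <;> field_simp <;> ring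

lemma contig_not_mul_contig {F : Type*} [Field F] {a : Fin 5 → F} (ha : Generic a)
    (hs : saal a ≠ 1) (i : Fin 5) :
    contig (shift a (step i (!decide (i < 3)))) i (decide (i < 3)) *
      contig a i (!decide (i < 3)) = 1 := by
  have hd {i j : Fin 5} (hij : i ≠ j) : a i - a j ≠ 0 := by simpa using ha.2 i j hij 0
  have h1 (i) : a i - 1 ≠ 0 := by simpa [sub_eq_zero] using ha.1 i 1
  have hsum (c : F) (hc : c = saal a - 1) : c ≠ 0 := hc ▸ sub_ne_zero.2 hs
  have num (x y z : F) (h) (h') (h'') (hxyz) :=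
    mul_eq_one_comm.1
      (num_mul_one (x := x - 1) (y := y) (z := z) (b := a 3) (c := a 4) h h' h'' hxyz)
  simp only [sub_add_cancel] at num
  fin_cases i <;>
    simp only [Fin.zero_eta, Fin.mk_one, Fin.reduceFinMk, Fin.reduceLT, lt_self_iff_false,
      decide_true, decide_false, Bool.not_true, Bool.not_false, contig, shift_step,
      shift_step_false, Fin.reduceEq, one_ne_zero, zero_ne_one, if_true, if_false]
  · exact num _ _ _ (h1 0) (hd (by decide)) (hd (by decide)) (hsum _ (by simp only [saal]; ring))
  · exact num _ _ _ (h1 1) (hd (by decide)) (hd (by decide)) (hsum _ (by simp only [saal]; ring))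
  · exact num _ _ _ (h1 2) (hd (by decide)) (hd (by decide)) (hsum _ (by simp only [saal]; ring))
  · exact den_mul_one (hsum _ (by simp only [saal])) (hd (by decide)) (hd (by decide))
      (hd (by decide))
  · exact den_mul_one (hsum _ (by simp only [saal]; ring)) (hd (by decide)) (hd (by decide))
      (hd (by decide))

/-- The vector `(h(a), h(a + 𝟏))`, which the contiguous matrices transport. -/
def pairVec (h : (Fin 5 → ℂ) → ℂ) (a : Fin 5 → ℂ) : Fin 2 → ℂ := ![h a, h (shift a 1)]

lemma ne_of_re_lt {z : ℂ} {x : ℝ} (h : x < z.re) : z ≠ x :=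
  fun e => h.ne' (by rw [e, Complex.ofReal_re])

section Transport

variable {h : (Fin 5 → ℂ) → ℂ} {a : Fin 5 → ℂ}

lemma pairVec_step_decide (hh : IsContiguous h) (ha : Generic a) (hs : 2 < (saal a).re)
    (i : Fin 5) : pairVec h (shift a (step i (decide (i < 3)))) =
      (contig a i (decide (i < 3))).mulVec (pairVec h a) := by
  have hs2 : saal a - 2 ≠ 0 := sub_ne_zero.2 (ne_of_re_lt hs)
  have hdir := hh.shift_dir ha (by linarith) i.succ
  have hdir_one := hh.shift_dir (ha.shift 1) (by rw [re_saal_shift_one]; linarith) i.succ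
  have hrec : h (shift a 2) = (phiThree a * h a + psi a * h (shift a 1)) / (saal a - 2) := by
    rw [eq_div_iff hs2, mul_comm, hh.recurrence ha hs]
  rw [shift_one_shift_one, hrec, shift_shift, add_comm] at hdir_one
  rw [contig_decide hs2, pairVec, pairVec, shift_shift, step_decide, hdir, hdir_one]
  funext r
  fin_cases r <;> simp [Matrix.mulVec, dotProduct, Fin.sum_univ_two]
  ring

lemma pairVec_step (hh : IsContiguous h) (ha : Generic a) (hs : 1 < (saal a).re) (i : Fin 5)
    (ε : Bool) (hs' : 1 < (saal (shift a (step i ε))).re) :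
    pairVec h (shift a (step i ε)) = (contig a i ε).mulVec (pairVec h a) := by
  rw [re_saal_shift, saal_step] at hs'
  by_cases hε : ε = decide (i < 3)
  · subst hε
    rw [if_pos rfl] at hs'
    push_cast at hs'
    exact pairVec_step_decide hh ha (by linarith) i
  · -- the step raises `s(a)`, and its inverse is a step of the first kind
    obtain rfl : ε = !decide (i < 3) := Bool.eq_not_of_ne hε
    have hback := pairVec_step_decide hh (ha.shift (step i (!decide (i < 3))))
      (by rw [re_saal_shift, saal_step, if_neg hε]; push_cast; linarith) i
    have hinv := mul_eq_one_comm.1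
      (contig_not_mul_contig ha (by simpa using ne_of_re_lt hs) i)
    have hcancel := step_not i (!decide (i < 3))
    rw [Bool.not_not] at hcancel
    rw [shift_shift, hcancel, shift_zero] at hback
    rw [hback, Matrix.mulVec_mulVec, hinv, Matrix.one_mulVec]

/-- All points that the path visits after its starting point lie in the half space `1 < Re s`. -/
def GoodPath : (Fin 5 → ℂ) → List (Fin 5 × Bool) → Prop
  | _, [] => True
  | b, e :: w => 1 < (saal (shift b (step e.1 e.2))).re ∧ GoodPath (shift b (step e.1 e.2)) w

lemma GoodPath.append {b : Fin 5 → ℂ} {w w' : List (Fin 5 × Bool)} (h : GoodPath b w)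
    (h' : GoodPath (shift b (endPt w)) w') : GoodPath b (w ++ w') := by
  induction w generalizing b with
  | nil => simpa [endPt, shift_zero] using h'
  | cons e w ih => exact ⟨h.1, ih h.2 (by rwa [shift_shift])⟩

lemma goodPath_of_increasing {b : Fin 5 → ℂ} {w : List (Fin 5 × Bool)}
    (hw : ∀ e ∈ w, saal (step e.1 e.2) = 1) (hb : 1 < (saal b).re) : GoodPath b w := by
  induction w generalizing b with
  | nil => trivial
  | cons e w ih =>
    have h1 : 1 < (saal (shift b (step e.1 e.2))).re := by
      rw [re_saal_shift, hw e List.mem_cons_self, Int.cast_one]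
      linarith
    exact ⟨h1, ih (fun e he => hw e (List.mem_cons_of_mem _ he)) h1⟩

lemma saal_endPt_nonpos {w : List (Fin 5 × Bool)} (hw : ∀ e ∈ w, saal (step e.1 e.2) = -1) :
    saal (endPt w) ≤ 0 := by
  induction w with
  | nil => exact le_rfl
  | cons e w ih =>
    rw [endPt, saal_add, hw e List.mem_cons_self]
    linarith [ih fun e he => hw e (List.mem_cons_of_mem _ he)]

lemma goodPath_of_decreasing {b : Fin 5 → ℂ} {w : List (Fin 5 × Bool)}
    (hw : ∀ e ∈ w, saal (step e.1 e.2) = -1) (hb : 1 < (saal (shift b (endPt w))).re) :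
    GoodPath b w := by
  induction w generalizing b with
  | nil => trivial
  | cons e w ih =>
    have hw' : ∀ e ∈ w, saal (step e.1 e.2) = -1 := fun e he => hw e (List.mem_cons_of_mem _ he)
    rw [endPt, ← shift_shift] at hb
    refine ⟨?_, ih hw' hb⟩
    have hle : ((saal (endPt w) : ℤ) : ℝ) ≤ 0 := Int.cast_nonpos.2 (saal_endPt_nonpos hw')
    rw [re_saal_shift] at hb
    linarith

/- Taking the steps that raise `s` first keeps the path above the smaller of the two end values. -/
lemma exists_goodPath {b : Fin 5 → ℂ} {p : Fin 5 → ℤ} (hb : 1 < (saal b).re)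
    (hp : 1 < (saal (shift b p)).re) : ∃ w, endPt w = p ∧ GoodPath b w := by
  set f : Fin 5 × Bool → Bool := fun e => saal (step e.1 e.2) = 1 with hf
  have hend : endPt ((axisPath p).filter f ++ (axisPath p).filter (!f ·)) = p :=
    (endPt_perm (List.filter_append_perm f (axisPath p))).trans (endPt_axisPath p)
  refine ⟨_, hend, (goodPath_of_increasing (fun e he => ?_) hb).append
    (goodPath_of_decreasing (fun e he => ?_) ?_)⟩
  · simpa [hf] using (List.mem_filter.1 he).2
  · have hne : saal (step e.1 e.2) ≠ 1 := by simpa [hf] using (List.mem_filter.1 he).2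
    rw [saal_step] at hne ⊢
    split_ifs at hne ⊢
    · rfl
    · exact absurd rfl hne
  · rwa [shift_shift, ← endPt_append, hend]

variable {R K : Type*} [CommRing R] [Field K] [Algebra R K] [IsFractionRing R K] {φ : R →+* ℂ}
  {x : Fin 5 → K} {b : Fin 5 → ℂ}

lemma pairVec_endPt (hh : IsContiguous h) (hx : ∀ i, HasValue φ (x i) (b i)) (hb : Generic b)
    (hs : 1 < (saal b).re) {w : List (Fin 5 × Bool)} (hw : GoodPath b w) :
    pairVec h (shift b (endPt w)) = (pathMat b w).mulVec (pairVec h b) ∧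
      ∀ r k, HasValue φ (pathMat x w r k) (pathMat b w r k) := by
  induction w generalizing x b with
  | nil => exact ⟨by rw [endPt, pathMat, shift_zero, Matrix.one_mulVec], hasValue_matrix_one⟩
  | cons e w ih =>
    obtain ⟨hpair, hval⟩ := ih (hasValue_shift hx _) (hb.shift _) hw.1 hw.2
    refine ⟨?_, hasValue_matrix_mul hval (hasValue_contig hx hb e.1 e.2 fun hi h => ?_)⟩
    · rw [endPt, pathMat, ← shift_shift, hpair, pairVec_step hh hb hs e.1 e.2 hw.1,
        Matrix.mulVec_mulVec]
    · have hgood := hw.1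
      rw [re_saal_shift, h, hi] at hgood
      norm_num at hgood

/- `M` is a value of `A(x; p)` rather than the matrix `A(b; p)`, because `s(b)` may be an integer
and path independence is not available at such `b`. -/
lemma exists_pairVec_shift (hh : IsContiguous h) (hx : ∀ i, HasValue φ (x i) (b i))
    (hxr : Regular x) (hb : Generic b) (hs : 1 < (saal b).re) {p : Fin 5 → ℤ}
    (hp : 1 < (saal (shift b p)).re) :
    ∃ M : Matrix (Fin 2) (Fin 2) ℂ, pairVec h (shift b p) = M.mulVec (pairVec h b) ∧
      ∀ r k, HasValue φ (connMat x p r k) (M r k) := by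
  obtain ⟨w, rfl, hw⟩ := exists_goodPath hs hp
  obtain ⟨hpair, hval⟩ := pairVec_endPt hh hx hb hs hw
  exact ⟨_, hpair, by rwa [← pathMat_eq_connMat hxr rfl]⟩

end Transport

/-! ### Nonvanishing of `r(a; p)` -/

section Periods

variable {F : Type*} [Field F]

lemma connMat_eq_of_rTwo_eq_zero {a : Fin 5 → F} (ha : Regular a) {p : Fin 5 → ℤ}
    (h0 : rTwo a p = 0) (h1 : rTwo (shift a 1) p = 0) :
    connMat a p = !![rOne a p, 0; 0, rOne (shift a 1) p] := by
  have e := connMat_mul_oneMat ha p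
  have e00 := congrFun (congrFun e 0) 0
  have e01 := congrFun (congrFun e 0) 1
  rw [rTwo] at h0 h1
  simp [Matrix.mul_apply, oneMat, h1] at e00 e01
  ext r k
  fin_cases r <;> fin_cases k <;> simp [rOne, h0, e00, e01]

lemma rOne_shift_two {a : Fin 5 → F} (ha : Regular a) {p : Fin 5 → ℤ}
    (h : ∀ q, rTwo (shift a q) p = 0) :
    rOne (shift a 2) p * phiThree a * (saal (shift a p) - 2) =
        rOne a p * phiThree (shift a p) * (saal a - 2) ∧
      rOne (shift a 2) p * psi a * (saal (shift a p) - 2) =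
        rOne (shift a 1) p * psi (shift a p) * (saal a - 2) := by
  have h2 : rTwo (shift (shift a 1) 1) p = 0 := by rw [shift_one_shift_one]; exact h 2
  have hs := ha.saal_sub_two_ne_zero
  have hsp := (ha.shift p).saal_sub_two_ne_zero
  have e := connMat_mul_oneMat ha p
  rw [connMat_eq_of_rTwo_eq_zero ha (by simpa [shift_zero] using h 0) (h 1),
    connMat_eq_of_rTwo_eq_zero (ha.shift 1) (h 1) h2, shift_one_shift_one] at e
  have e10 := congrFun (congrFun e 1) 0
  have e11 := congrFun (congrFun e 1) 1
  simp only [oneMat, Matrix.mul_fin_two, Matrix.of_apply, Matrix.cons_val', Matrix.cons_val_zero,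
    Matrix.cons_val_one, Matrix.cons_val_fin_one, mul_zero, zero_mul, zero_add, add_zero]
    at e10 e11
  field_simp at e10 e11
  exact ⟨by linear_combination e10, by linear_combination e11⟩

/-- The lattice vector `p` is a period of the rational function
`ψ(a) ψ(a + 𝟏) / (φ₃(a + 𝟏) (s(a) - 2))`; the identity is written without denominators. -/
def HasPeriod (p : Fin 5 → ℤ) (a : Fin 5 → F) : Prop :=
  psi (shift a p) * psi (shift a (1 + p)) * phiThree (shift a 1) * (saal a - 2) =
    psi a * psi (shift a 1) * phiThree (shift a (1 + p)) * (saal (shift a p) - 2)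

lemma hasPeriod_of_rTwo_eq_zero {a : Fin 5 → F} (ha : Regular a) {p : Fin 5 → ℤ}
    (h : ∀ q, rTwo (shift a q) p = 0) : HasPeriod p a := by
  have hρ : rOne (shift a 1) p ≠ 0 := fun h0 => by
    apply smallDelta_ne_zero (ha.shift 1) p
    have e : connMat (shift a 1) p 0 1 = 0 := h 1
    have e' : connMat (shift a 1) p 0 0 = 0 := h0
    rw [← det_connMat (ha.shift 1), Matrix.det_fin_two, e, e', zero_mul, zero_mul, sub_zero]
  obtain ⟨-, hpsi⟩ := rOne_shift_two ha h
  obtain ⟨hphi', hpsi'⟩ := rOne_shift_two (ha.shift 1) fun q => by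
    rw [shift_shift]; exact h (1 + q)
  simp only [shift_shift, one_add_one_eq_two] at hpsi hphi' hpsi'
  refine mul_left_cancel₀ (mul_ne_zero hρ (ha.shift 1).saal_sub_two_ne_zero) ?_
  linear_combination -(psi (shift a (1 + p)) * phiThree (shift a 1) * (saal (shift a 1) - 2)) *
      hpsi - psi a * (saal (shift a p) - 2) * phiThree (shift a 1) * hpsi' +
    psi a * (saal (shift a p) - 2) * psi (shift a 1) * hphi'

variable {p : Fin 5 → ℤ}

lemma apply_eq_zero_of_hasPeriod (h : ∀ a : Fin 5 → ℂ, HasPeriod p a) {i : Fin 5} (hi : i < 3) :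
    p i = 0 := by
  -- At these points `φ₃(a + 𝟏)` vanishes, and of the other factors only `φ₃(a + 𝟏 + p)` can.
  have hI (n : ℤ) : Complex.I + (1 + n) ≠ 0 := fun e => by simpa using congrArg Complex.im e
  obtain rfl | rfl | rfl : i = 0 ∨ i = 1 ∨ i = 2 := by omega
  · simpa [HasPeriod, psi, phiThree, shift, saal, hI, Complex.ext_iff] using
      h ![-1, Complex.I, Complex.I, Complex.I, 0]
  · simpa [HasPeriod, psi, phiThree, shift, saal, hI, Complex.ext_iff] using
      h ![Complex.I, -1, Complex.I, Complex.I, 0]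
  · simpa [HasPeriod, psi, phiThree, shift, saal, hI, Complex.ext_iff] using
      h ![Complex.I, Complex.I, -1, Complex.I, 0]

lemma saal_eq_zero_of_hasPeriod (h : ∀ a : Fin 5 → ℂ, HasPeriod p a) : saal p = 0 := by
  have h0 := apply_eq_zero_of_hasPeriod h (i := 0) (by decide)
  have h1 := apply_eq_zero_of_hasPeriod h (i := 1) (by decide)
  have h2 := apply_eq_zero_of_hasPeriod h (i := 2) (by decide)
  have e := h ![0, 0, 0, 2, 0]
  simp only [HasPeriod, psi, phiThree, shift, saal, h0, h1, h2, Matrix.cons_val, Pi.add_apply,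
    Pi.one_apply] at e
  have hp : ((p 3 + p 4 : ℤ) : ℂ) = 0 := by
    push_cast at e ⊢
    linear_combination -e / 4
  simp only [saal, h0, h1, h2]
  have : p 3 + p 4 = 0 := by exact_mod_cast hp
  omega

lemma apply_three_eq_zero_of_hasPeriod (h : ∀ a : Fin 5 → ℂ, HasPeriod p a) : p 3 = 0 := by
  have h0 := apply_eq_zero_of_hasPeriod h (i := 0) (by decide)
  have h1 := apply_eq_zero_of_hasPeriod h (i := 1) (by decide)
  have h2 := apply_eq_zero_of_hasPeriod h (i := 2) (by decide)
  have h4 : p 4 = -p 3 := by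
    have hs := saal_eq_zero_of_hasPeriod h
    simp only [saal, h0, h1, h2] at hs
    omega
  have key (y z : ℂ) (hyz : y + z ≠ 2) :
      (1 - (y + p 3) * (z - p 3)) * (7 - (y + 1 + p 3) * (z + 1 - p 3)) =
        (1 - y * z) * (7 - (y + 1) * (z + 1)) := by
    have e := h ![0, 0, 0, y, z]
    simp [HasPeriod, psi, phiThree, shift, saal, h0, h1, h2, h4] at e
    exact mul_right_cancel₀ (sub_ne_zero.2 hyz) (by linear_combination e)
  have k00 := key 0 0 (by norm_num)
  have hadd : (p 3 : ℂ) * (1 + p 3) = 0 := by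
    linear_combination (key 0 1 (by norm_num) + key 0 (-1) (by norm_num) - 2 * k00) / 2
  have hsub : (p 3 : ℂ) * (1 - p 3) = 0 := by
    linear_combination -(key 1 0 (by norm_num) + key (-1) 0 (by norm_num) - 2 * k00) / 2
  have hp : (p 3 : ℂ) = 0 := by linear_combination (hadd + hsub) / 2
  exact_mod_cast hp

lemma eq_zero_of_hasPeriod (h : ∀ a : Fin 5 → ℂ, HasPeriod p a) : p = 0 := by
  have h3 := apply_three_eq_zero_of_hasPeriod h
  have hlt {i : Fin 5} : i < 3 → p i = 0 := apply_eq_zero_of_hasPeriod h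
  have hs := saal_eq_zero_of_hasPeriod h
  have h0 : p 0 = 0 := hlt (by decide)
  have h1 : p 1 = 0 := hlt (by decide)
  have h2 : p 2 = 0 := hlt (by decide)
  simp only [saal] at hs
  funext i
  fin_cases i <;> simp only [Fin.mk_zero, Fin.mk_one, Fin.reduceFinMk, Pi.zero_apply] <;> omega

end Periods

section Evaluation

/-- Evaluation of polynomials over `ℚ` at a point of `ℂ⁵`. -/
noncomputable def evalAt (b : Fin 5 → ℂ) : MvPolynomial (Fin 5) ℚ →+* ℂ :=
  (MvPolynomial.aeval b).toRingHom

lemma hasValue_varA (b : Fin 5 → ℂ) (i : Fin 5) : HasValue (evalAt b) (varA i) (b i) := by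
  simpa [evalAt, varA] using hasValue_algebraMap (K := RatA) (φ := evalAt b) (MvPolynomial.X i)

/-- The translation `P(a) ↦ P(a + p)` on polynomials. -/
noncomputable def translatePoly {R : Type*} [CommRing R] (p : Fin 5 → ℤ) :
    MvPolynomial (Fin 5) R →ₐ[R] MvPolynomial (Fin 5) R :=
  MvPolynomial.aeval fun i => MvPolynomial.X i + MvPolynomial.C (p i : R)

lemma translatePoly_neg_translatePoly {R : Type*} [CommRing R] (p : Fin 5 → ℤ)
    (P : MvPolynomial (Fin 5) R) : translatePoly (-p) (translatePoly p P) = P := by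
  have h : (translatePoly (-p)).comp (translatePoly p) = AlgHom.id R _ := by
    ext i; simp [translatePoly]
  exact DFunLike.congr_fun h P

lemma translatePoly_injective {R : Type*} [CommRing R] (p : Fin 5 → ℤ) :
    Function.Injective (translatePoly (R := R) p) :=
  Function.LeftInverse.injective (translatePoly_neg_translatePoly p)

/-- The translation `u(a) ↦ u(a + p)` on rational functions. -/
noncomputable def translateRat (p : Fin 5 → ℤ) : RatA →+* RatA :=
  IsFractionRing.map (A := MvPolynomial (Fin 5) ℚ) (B := MvPolynomial (Fin 5) ℚ)
    (j := (translatePoly (R := ℚ) p).toRingHom) (translatePoly_injective p)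

lemma translateRat_varA (p : Fin 5 → ℤ) : translateRat p ∘ varA = shift varA p := by
  funext i
  simp [translateRat, varA, IsFractionRing.map, IsLocalization.map_eq, shift, translatePoly]

lemma rTwo_shift_varA (p q : Fin 5 → ℤ) :
    rTwo (shift varA q) p = translateRat q (rTwo varA p) := by
  rw [← translateRat_varA, rTwo, connMat_map]
  rfl

lemma rTwo_varA_ne_zero {p : Fin 5 → ℤ} (hp : p ≠ 0) : rTwo varA p ≠ 0 := fun h0 => by
  refine hp (eq_zero_of_hasPeriod fun b => ?_)
  have hx := hasValue_varA b
  have h : HasPeriod p varA := hasPeriod_of_rTwo_eq_zero regular_varA fun q => by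
    rw [rTwo_shift_varA, h0, map_zero]
  have hl := (((hasValue_psi (hasValue_shift hx p)).mul
    (hasValue_psi (hasValue_shift hx (1 + p)))).mul
    (hasValue_phiThree (hasValue_shift hx 1))).mul ((hasValue_saal hx).sub hasValue_two)
  have hr := (((hasValue_psi hx).mul (hasValue_psi (hasValue_shift hx 1))).mul
    (hasValue_phiThree (hasValue_shift hx (1 + p)))).mul
    ((hasValue_saal (hasValue_shift hx p)).sub hasValue_two)
  rw [h] at hl
  exact hl.unique hr

lemma bigDelta_varA_ne_zero {p q : Fin 5 → ℤ} (hpq : p ≠ q) : bigDelta varA p q ≠ 0 := by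
  rw [bigDelta_eq regular_varA, rTwo_shift_varA]
  exact mul_ne_zero (smallDelta_ne_zero regular_varA p)
    ((map_ne_zero _).2 (rTwo_varA_ne_zero (sub_ne_zero.2 hpq.symm)))

end Evaluation

/-! ### A Riccati equation without rational solutions -/

section WeightedDegree

open MvPolynomial (weightedTotalDegree)

variable {σ R : Type*} [CommRing R] (w : σ → ℕ)

/-- The substitution `Xᵢ ↦ Xᵢ T ^ wᵢ`, which turns the weighted degree into the degree in `T`. -/
noncomputable def weightHom : MvPolynomial σ R →ₐ[R] Polynomial (MvPolynomial σ R) :=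
  MvPolynomial.aeval fun i => Polynomial.C (MvPolynomial.X i) * Polynomial.X ^ w i

lemma weightHom_X (i : σ) : weightHom (R := R) w (MvPolynomial.X i) =
    Polynomial.C (MvPolynomial.X i) * Polynomial.X ^ w i :=
  MvPolynomial.aeval_X _ i

lemma weightHom_monomial (m : σ →₀ ℕ) (c : R) :
    weightHom w (MvPolynomial.monomial m c) =
      Polynomial.monomial (Finsupp.weight w m) (MvPolynomial.monomial m c) := by
  rw [weightHom, MvPolynomial.aeval_monomial, ← Polynomial.C_mul_X_pow_eq_monomial,
    MvPolynomial.monomial_eq, Finsupp.weight_apply, map_mul, mul_assoc]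
  congr 1
  simp only [Finsupp.prod, Finsupp.sum, mul_pow, Finset.prod_mul_distrib, map_prod, map_pow,
    ← pow_mul, ← Finset.prod_pow_eq_pow_sum, smul_eq_mul, mul_comm (w _)]

lemma coeff_weightHom (P : MvPolynomial σ R) (m : σ →₀ ℕ) :
    ((weightHom w P).coeff (Finsupp.weight w m)).coeff m = P.coeff m := by
  classical
  induction P using MvPolynomial.induction_on' with
  | monomial u a =>
    rw [weightHom_monomial, Polynomial.coeff_monomial, MvPolynomial.coeff_monomial]
    by_cases h : u = m
    · simp [h]
    · split_ifs <;> simp [h]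
  | add P Q hP hQ => rw [map_add, Polynomial.coeff_add, MvPolynomial.coeff_add, hP, hQ,
      MvPolynomial.coeff_add]

lemma weightHom_injective : Function.Injective (weightHom (R := R) w) :=
  fun P Q h => MvPolynomial.ext _ _ fun m => by rw [← coeff_weightHom w, h, coeff_weightHom]

variable {w}

lemma natDegree_aeval_le {A : Type*} [CommRing A] [Algebra R A] {g : σ → Polynomial A}
    (hg : ∀ i, (g i).natDegree ≤ w i) (P : MvPolynomial σ R) :
    (MvPolynomial.aeval g P).natDegree ≤ weightedTotalDegree w P := by
  rw [MvPolynomial.aeval_def, MvPolynomial.eval₂_eq]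
  refine Polynomial.natDegree_sum_le_of_forall_le _ _ fun m hm =>
    le_trans ?_ (MvPolynomial.le_weightedTotalDegree w hm)
  have hprod : (∏ i ∈ m.support, g i ^ m i).natDegree ≤ Finsupp.weight w m := by
    rw [Finsupp.weight_apply]
    refine (Polynomial.natDegree_prod_le _ _).trans (Finset.sum_le_sum fun i _ => ?_)
    exact Polynomial.natDegree_pow_le.trans (Nat.mul_le_mul_left _ (hg i))
  exact (Polynomial.natDegree_C_mul_le _ _).trans hprod

lemma natDegree_weightHom (P : MvPolynomial σ R) :
    (weightHom w P).natDegree = weightedTotalDegree w P := by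
  refine (natDegree_aeval_le (fun i => Polynomial.natDegree_C_mul_X_pow_le _ _) P).antisymm ?_
  refine Finset.sup_le fun m hm => Polynomial.le_natDegree_of_ne_zero
    fun (h : (weightHom w P).coeff _ = 0) => MvPolynomial.mem_support_iff.1 hm ?_
  rw [← coeff_weightHom w, h, MvPolynomial.coeff_zero]

lemma weightedTotalDegree_map {S : Type*} [CommRing S] {f : R →+* S} (hf : Function.Injective f)
    (P : MvPolynomial σ R) :
    weightedTotalDegree w (MvPolynomial.map f P) = weightedTotalDegree w P := by
  rw [weightedTotalDegree, MvPolynomial.support_map_of_injective _ hf, weightedTotalDegree]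

lemma weightedTotalDegree_translatePoly_le (w : Fin 5 → ℕ) (p : Fin 5 → ℤ)
    (P : MvPolynomial (Fin 5) R) :
    weightedTotalDegree w (translatePoly p P) ≤ weightedTotalDegree w P := by
  have h : (weightHom w).comp (translatePoly p) = MvPolynomial.aeval (R := R) fun i =>
      Polynomial.C (MvPolynomial.X i) * Polynomial.X ^ w i +
        Polynomial.C (MvPolynomial.C (p i : R)) := by
    ext1 i
    simp [translatePoly, weightHom_X]
  rw [← natDegree_weightHom, ← AlgHom.comp_apply, h]
  exact natDegree_aeval_le (fun i => Polynomial.natDegree_add_C.trans_le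
    (Polynomial.natDegree_C_mul_X_pow_le _ _)) P

lemma weightedTotalDegree_translatePoly (w : Fin 5 → ℕ) (p : Fin 5 → ℤ)
    (P : MvPolynomial (Fin 5) R) :
    weightedTotalDegree w (translatePoly p P) = weightedTotalDegree w P := by
  refine (weightedTotalDegree_translatePoly_le w p P).antisymm ?_
  simpa only [translatePoly_neg_translatePoly] using
    weightedTotalDegree_translatePoly_le w (-p) (translatePoly p P)

end WeightedDegree

section Riccati

/-- The Riccati equation of the recurrence `(s(c) - 2) h'' = ψ(c) h' + φ₃(c) h`, where `T` is the
translation by `𝟏`: it holds if `u h + v h' = 0` and `T u h' + T v h'' = 0`. -/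
def IsRiccati {M : Type*} [CommRing M] (T : M →+* M) (c : Fin 5 → M) (u v : M) : Prop :=
  u * ((saal c - 2) * T u + psi c * T v) = phiThree c * v * T v

lemma IsRiccati.of_mul_left {M : Type*} [Field M] {T : M →+* M} {c : Fin 5 → M} {u v z : M}
    (hz : z ≠ 0) (h : IsRiccati T c (z * u) (z * v)) : IsRiccati T c u v := by
  refine mul_left_cancel₀ (mul_ne_zero hz ((map_ne_zero T).2 hz)) ?_
  simp only [IsRiccati, map_mul] at h
  linear_combination h

lemma IsRiccati.mul_left {M : Type*} [CommRing M] {T : M →+* M} {c : Fin 5 → M} {u v : M}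
    (h : IsRiccati T c u v) (z : M) : IsRiccati T c (z * u) (z * v) := by
  simp only [IsRiccati, map_mul] at h ⊢
  linear_combination z * T z * h

lemma IsRiccati.of_map {M N : Type*} [CommRing M] [CommRing N] {T : M →+* M} {T' : N →+* N}
    {f : M →+* N} (hf : Function.Injective f) (hT : ∀ x, T' (f x) = f (T x)) {c : Fin 5 → M}
    {u v : M} (h : IsRiccati T' (f ∘ c) (f u) (f v)) : IsRiccati T c u v := by
  refine hf ?_
  simpa only [IsRiccati, saal_map, psi_map, phiThree_map, hT, map_mul, map_add, map_sub,
    map_ofNat] using h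

open Polynomial in
lemma riccati_natDegree {A : Type*} [CommRing A] [IsDomain A] {s ψ φ p q p' q' : A[X]}
    (hs : s.natDegree = 2) (hψ : ψ.natDegree ≤ 2) (hφ : φ.natDegree = 3)
    (hp' : p' ≠ 0) (hq : q ≠ 0) (hq' : q' ≠ 0)
    (hpp : p'.natDegree = p.natDegree) (hqq : q'.natDegree = q.natDegree) :
    p * (s * p' + ψ * q') ≠ φ * q * q' := by
  -- If `deg p ≤ deg q`, the right-hand side has the larger degree; otherwise the degrees of the
  -- two sides have different parities.
  intro e
  have hs0 : s ≠ 0 := ne_zero_of_natDegree_gt (hs ▸ two_pos)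
  have hφ0 : φ ≠ 0 := ne_zero_of_natDegree_gt (hφ ▸ three_pos)
  have hright : (φ * q * q').natDegree = 3 + 2 * q.natDegree := by
    rw [natDegree_mul (mul_ne_zero hφ0 hq) hq', natDegree_mul hφ0 hq, hφ, hqq]
    ring
  have hsp : (s * p').natDegree = 2 + p.natDegree := by rw [natDegree_mul hs0 hp', hs, hpp]
  have hψq : (ψ * q').natDegree ≤ 2 + q.natDegree := natDegree_mul_le.trans (by omega)
  rcases le_or_gt p.natDegree q.natDegree with h | h
  · have hsum : (s * p' + ψ * q').natDegree ≤ max (2 + p.natDegree) (2 + q.natDegree) :=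
      (natDegree_add_le _ _).trans (max_le_max hsp.le hψq)
    have hleft : (p * (s * p' + ψ * q')).natDegree ≤ _ := natDegree_mul_le
    rw [e, hright] at hleft
    omega
  · have hsum : (s * p' + ψ * q').natDegree = 2 + p.natDegree := by
      rw [natDegree_add_eq_left_of_natDegree_lt (by omega), hsp]
    have hleft := natDegree_mul (ne_zero_of_natDegree_gt h)
      (ne_zero_of_natDegree_gt (hsum ▸ (by omega : 0 < 2 + p.natDegree)))
    rw [e, hright, hsum] at hleft
    omega

/-- Weights for which `φ₃` has larger degree than `s` and `ψ`, and the degrees of `φ₃` and `s` have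
different parities. -/
def riccatiWeight : Fin 5 → ℕ := ![1, 1, 1, 2, 0]

variable {K : Type*} [Field K]

lemma natDegree_weightHom_saal :
    (weightHom riccatiWeight (saal MvPolynomial.X - 2 : MvPolynomial (Fin 5) K)).natDegree =
      2 := by
  have e : weightHom riccatiWeight (saal MvPolynomial.X - 2 : MvPolynomial (Fin 5) K) =
      Polynomial.C (MvPolynomial.X 3) * Polynomial.X ^ 2 +
      Polynomial.C (-(MvPolynomial.X 0 + MvPolynomial.X 1 + MvPolynomial.X 2)) * Polynomial.X +
      Polynomial.C (MvPolynomial.X 4 - 2) := by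
    simp only [saal, map_sub, map_add, map_neg, weightHom_X, map_ofNat]
    simp [riccatiWeight]
    ring
  rw [e]
  exact Polynomial.natDegree_quadratic (MvPolynomial.X_ne_zero 3)

lemma natDegree_weightHom_psi_le :
    (weightHom riccatiWeight (psi MvPolynomial.X : MvPolynomial (Fin 5) K)).natDegree ≤ 2 := by
  simp only [psi, map_sub, map_add, map_mul, map_one, weightHom_X]
  simp only [riccatiWeight, Matrix.cons_val]
  compute_degree

lemma natDegree_weightHom_phiThree :
    (weightHom riccatiWeight (phiThree MvPolynomial.X : MvPolynomial (Fin 5) K)).natDegree =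
      3 := by
  have e : weightHom riccatiWeight (phiThree MvPolynomial.X : MvPolynomial (Fin 5) K) =
      Polynomial.C (MvPolynomial.X 0 * MvPolynomial.X 1 * MvPolynomial.X 2) *
        Polynomial.X ^ 3 := by
    simp only [phiThree, map_mul, weightHom_X]
    simp [riccatiWeight]
    ring
  rw [e]
  exact Polynomial.natDegree_C_mul_X_pow 3 _ (mul_ne_zero (mul_ne_zero (MvPolynomial.X_ne_zero 0)
    (MvPolynomial.X_ne_zero 1)) (MvPolynomial.X_ne_zero 2))

/-- The translation by `𝟏`, acting by `τ` on the coefficients. -/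
noncomputable def twist (τ : K →+* K) : MvPolynomial (Fin 5) K →+* MvPolynomial (Fin 5) K :=
  (translatePoly 1 : MvPolynomial (Fin 5) K →ₐ[K] _).toRingHom.comp (MvPolynomial.map τ)

lemma twist_injective (τ : K →+* K) : Function.Injective (twist τ) :=
  (translatePoly_injective 1).comp (MvPolynomial.map_injective τ τ.injective)

lemma natDegree_weightHom_twist (w : Fin 5 → ℕ) (τ : K →+* K) (P : MvPolynomial (Fin 5) K) :
    (weightHom w (twist τ P)).natDegree = (weightHom w P).natDegree := by
  rw [natDegree_weightHom, natDegree_weightHom]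
  exact (weightedTotalDegree_translatePoly w 1 _).trans (weightedTotalDegree_map τ.injective P)

lemma IsRiccati.eq_zero_of_twist {τ : K →+* K} {P Q : MvPolynomial (Fin 5) K}
    (h : IsRiccati (twist τ) MvPolynomial.X P Q) : P = 0 ∧ Q = 0 := by
  have htwist {P} (hP : P ≠ 0) : twist τ P ≠ 0 := (map_ne_zero_iff _ (twist_injective τ)).2 hP
  have hweight {P : MvPolynomial (Fin 5) K} (hP : P ≠ 0) : weightHom riccatiWeight P ≠ 0 :=
    (map_ne_zero_iff _ (weightHom_injective _)).2 hP
  have hs0 : (saal MvPolynomial.X - 2 : MvPolynomial (Fin 5) K) ≠ 0 := fun e => by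
    simpa [e] using natDegree_weightHom_saal (K := K)
  have hφ0 : (phiThree MvPolynomial.X : MvPolynomial (Fin 5) K) ≠ 0 := fun e => by
    simpa [e] using natDegree_weightHom_phiThree (K := K)
  rw [IsRiccati] at h
  by_cases hQ : Q = 0
  · subst hQ
    by_contra hP
    have hP : P ≠ 0 := fun e => hP ⟨e, rfl⟩
    exact mul_ne_zero hP (mul_ne_zero hs0 (htwist hP)) (by simpa using h)
  by_cases hP : P = 0
  · subst hP
    exact absurd h.symm (by simpa using ⟨⟨hφ0, hQ⟩, htwist hQ⟩)
  have h' := congrArg (weightHom riccatiWeight) h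
  simp only [map_mul, map_add] at h'
  exact absurd h' (riccati_natDegree natDegree_weightHom_saal natDegree_weightHom_psi_le
    natDegree_weightHom_phiThree (hweight (htwist hP)) (hweight hQ) (hweight (htwist hQ))
    (natDegree_weightHom_twist _ τ P) (natDegree_weightHom_twist _ τ Q))

variable {M : Type*} [Field M] {c : Fin 5 → M} {T : M →+* M} {k : Subfield M}

lemma exists_aeval_of_mem_closure (hal : AlgebraicIndependent k c) {x : M}
    (hx : x ∈ Subfield.closure ((k : Set M) ∪ Set.range c)) :
    ∃ P D : MvPolynomial (Fin 5) k, D ≠ 0 ∧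
      MvPolynomial.aeval c D * x = MvPolynomial.aeval c P := by
  have hk : Set.range (algebraMap k M) = k := Subtype.range_coe
  rw [← hk, ← IntermediateField.adjoin_toSubfield, IntermediateField.mem_toSubfield,
    IntermediateField.mem_adjoin_range_iff] at hx
  obtain ⟨P, D, rfl⟩ := hx
  by_cases hD : D = 0
  · exact ⟨0, 1, one_ne_zero, by simp [hD]⟩
  · exact ⟨P, D, hD, mul_div_cancel₀ _ ((map_ne_zero_iff _ hal).2 hD)⟩

lemma map_aeval_twist {τ : k →+* k} (hτ : ∀ f : k, (τ f : M) = T f) (hc : ∀ i, T (c i) = c i + 1)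
    (P : MvPolynomial (Fin 5) k) :
    T (MvPolynomial.aeval c P) = MvPolynomial.aeval c (twist τ P) := by
  have h : T.comp (MvPolynomial.aeval (R := k) c : MvPolynomial (Fin 5) k →+* M) =
      (MvPolynomial.aeval (R := k) c : MvPolynomial (Fin 5) k →+* M).comp (twist τ) := by
    refine MvPolynomial.ringHom_ext (fun r => ?_) fun i => ?_
    · simp only [twist, translatePoly, RingHom.coe_comp, RingHom.coe_coe, Function.comp_apply,
        MvPolynomial.aeval_C, AlgHom.toRingHom_eq_coe, MvPolynomial.map_C,
        MvPolynomial.algebraMap_eq]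
      exact (hτ r).symm
    · simp [twist, translatePoly, hc]
  exact RingHom.congr_fun h P

lemma IsRiccati.eq_zero_of_mem_closure (hT : ∀ f ∈ k, T f ∈ k) (hc : ∀ i, T (c i) = c i + 1)
    (hal : AlgebraicIndependent k c) {x y : M}
    (hx : x ∈ Subfield.closure ((k : Set M) ∪ Set.range c))
    (hy : y ∈ Subfield.closure ((k : Set M) ∪ Set.range c))
    (h : IsRiccati T c x y) : x = 0 ∧ y = 0 := by
  obtain ⟨P, D, hD, hP⟩ := exists_aeval_of_mem_closure hal hx
  obtain ⟨Q, E, hE, hQ⟩ := exists_aeval_of_mem_closure hal hy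
  let α : MvPolynomial (Fin 5) k →+* M := (MvPolynomial.aeval c).toRingHom
  replace hP : α D * x = α P := hP
  replace hQ : α E * y = α Q := hQ
  have hcα : c = α ∘ MvPolynomial.X := funext fun i => (MvPolynomial.aeval_X c i).symm
  have hDE : α (D * E) ≠ 0 := (map_ne_zero_iff α hal).2 (mul_ne_zero hD hE)
  have hx' : α (D * E) * x = α (P * E) := by
    rw [map_mul, map_mul, mul_right_comm, hP]
  have hy' : α (D * E) * y = α (D * Q) := by
    rw [map_mul, map_mul, mul_assoc, hQ]
  let τ : k →+* k := (T.comp k.subtype).codRestrict k fun f => hT f f.2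
  have hR := h.mul_left (α (D * E))
  rw [hx', hy', hcα] at hR
  obtain ⟨hPE, hDQ⟩ :=
    (hR.of_map hal (map_aeval_twist (τ := τ) (fun _ => rfl) hc)).eq_zero_of_twist
  rw [hPE, map_zero] at hx'
  rw [hDQ, map_zero] at hy'
  exact ⟨(mul_eq_zero.1 hx').resolve_left hDE, (mul_eq_zero.1 hy').resolve_left hDE⟩

end Riccati

/-! ### Meromorphic functions and their values at real points -/

section RealPoints

variable {E F : Type*} [NormedAddCommGroup E] [NormedSpace ℂ E] [NormedAddCommGroup F]
  [NormedSpace ℂ F]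

lemma eq_zero_on_line {f : E → F} (hf : AnalyticOnNhd ℂ f Set.univ) {a v : E}
    (h : ∀ᶠ t : ℝ in 𝓝 0, f (a + (t : ℂ) • v) = 0) (z : ℂ) : f (a + z • v) = 0 := by
  have hline : AnalyticOnNhd ℂ (fun z : ℂ => f (a + z • v)) Set.univ := fun z _ =>
    (hf (a + z • v) (Set.mem_univ _)).fun_comp (f := fun z : ℂ => a + z • v)
      (analyticAt_const.add (analyticAt_id.smul analyticAt_const))
  have hcoe : Tendsto ((↑) : ℝ → ℂ) (𝓝[≠] 0) (𝓝[≠] 0) := by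
    refine tendsto_nhdsWithin_of_tendsto_nhds_of_eventually_within _ ?_ ?_
    · exact (Complex.continuous_ofReal.tendsto' 0 0 Complex.ofReal_zero).mono_left
        nhdsWithin_le_nhds
    · filter_upwards [self_mem_nhdsWithin] with t ht
      exact Complex.ofReal_ne_zero.2 ht
  have hfreq : ∃ᶠ z : ℂ in 𝓝[≠] 0, f (a + z • v) = 0 :=
    hcoe.frequently (h.filter_mono nhdsWithin_le_nhds).frequently
  exact congrFun (hline.eq_of_frequently_eq (g := fun _ => (0 : F)) analyticOnNhd_const hfreq) z

variable {ι : Type*}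

/-- The inclusion of the real points in `ℂ^ι`. -/
def ofRealVec (x : ι → ℝ) : ι → ℂ := fun i => x i

lemma continuous_ofRealVec : Continuous (ofRealVec (ι := ι)) :=
  continuous_pi fun i => Complex.continuous_ofReal.comp (continuous_apply i)

lemma ofRealVec_add_smul (x y : ι → ℝ) (t : ℝ) :
    ofRealVec (x + t • y) = ofRealVec x + (t : ℂ) • ofRealVec y := by
  funext i
  simp [ofRealVec]

lemma ofRealVec_re_add_im (w : ι → ℂ) :
    ofRealVec (fun i => (w i).re) + Complex.I • ofRealVec (fun i => (w i).im) = w := by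
  funext i
  simp [ofRealVec, mul_comm Complex.I, Complex.re_add_im]

variable [Fintype ι] {f : (ι → ℂ) → F}

lemma eq_zero_of_forall_ofRealVec (hf : AnalyticOnNhd ℂ f Set.univ)
    (h : ∀ x, f (ofRealVec x) = 0) : f = 0 := by
  funext w
  have hw := eq_zero_on_line hf (a := ofRealVec fun i => (w i).re)
    (v := ofRealVec fun i => (w i).im)
    (Eventually.of_forall fun t => by rw [← ofRealVec_add_smul, h]) Complex.I
  rwa [ofRealVec_re_add_im] at hw

lemma eq_zero_of_ofRealVec_of_isOpen (hf : AnalyticOnNhd ℂ f Set.univ) {O : Set (ι → ℝ)}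
    (hO : IsOpen O) (hne : O.Nonempty) (h : ∀ x ∈ O, f (ofRealVec x) = 0) : f = 0 := by
  obtain ⟨x₀, hx₀⟩ := hne
  refine eq_zero_of_forall_ofRealVec hf fun y => ?_
  have hcont : Continuous fun t : ℝ => x₀ + t • (y - x₀) := by fun_prop
  have hev : ∀ᶠ t : ℝ in 𝓝 0, x₀ + t • (y - x₀) ∈ O :=
    hcont.tendsto 0 (hO.mem_nhds (by simpa using hx₀))
  have hy := eq_zero_on_line hf (a := ofRealVec x₀) (v := ofRealVec (y - x₀))
    (hev.mono fun t ht => by rw [← ofRealVec_add_smul, h _ ht]) ((1 : ℝ) : ℂ)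
  rwa [← ofRealVec_add_smul, one_smul, add_sub_cancel] at hy

end RealPoints

lemma isOpen_setOf_forall_ne_intCast {E : Type*} [TopologicalSpace E] {l : E → ℝ}
    (hl : Continuous l) : IsOpen {x | ∀ n : ℤ, l x ≠ n} := by
  have h : {x | ∀ n : ℤ, l x ≠ n} = l ⁻¹' (Set.range ((↑) : ℤ → ℝ))ᶜ := by
    ext x
    simp [eq_comm]
  exact h ▸ Int.isClosedEmbedding_coe_real.isClosed_range.isOpen_compl.preimage hl

lemma dense_setOf_forall_ne_intCast {E : Type*} [TopologicalSpace E] {l : E → ℝ}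
    (hl : IsOpenMap l) : Dense {x | ∀ n : ℤ, l x ≠ n} := by
  refine (((Set.countable_range ((↑) : ℤ → ℝ)).dense_compl ℝ).preimage hl).mono fun x hx n e => ?_
  exact hx ⟨n, e.symm⟩

/-- The linear forms whose values at a regular point are not integers. -/
def regularForm :
    Fin 5 ⊕ {ij : Fin 5 × Fin 5 // ij.1 ≠ ij.2} ⊕ Unit → (Fin 5 → ℝ) →L[ℝ] ℝ
  | .inl i => .proj i
  | .inr (.inl ij) => .proj ij.1.1 - .proj ij.1.2
  | .inr (.inr _) => .proj 3 + .proj 4 - .proj 0 - .proj 1 - .proj 2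

lemma regularForm_ne_zero : ∀ k, regularForm k ≠ 0
  | .inl i, h => by simpa [regularForm] using DFunLike.congr_fun h (Pi.single i 1)
  | .inr (.inl ij), h => by
    simpa [regularForm, ij.2.symm] using DFunLike.congr_fun h (Pi.single ij.1.1 1)
  | .inr (.inr _), h => by simpa [regularForm] using DFunLike.congr_fun h (Pi.single 3 1)

lemma regular_ofRealVec {x : Fin 5 → ℝ} (h : ∀ k, ∀ n : ℤ, regularForm k x ≠ n) :
    Regular (ofRealVec x) := by
  refine ⟨⟨fun i n e => h (.inl i) n ?_, fun i j hij n e => h (.inr (.inl ⟨(i, j), hij⟩)) n ?_⟩,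
    fun n e => h (.inr (.inr ())) n ?_⟩ <;>
  · simp only [ofRealVec, saal] at e
    simp only [regularForm, _root_.sub_apply, _root_.add_apply,
      ContinuousLinearMap.proj_apply]
    exact_mod_cast e

lemma dense_regular : Dense {x : Fin 5 → ℝ | Regular (ofRealVec x)} := by
  refine (dense_iInter_of_isOpen
    (fun k => isOpen_setOf_forall_ne_intCast (regularForm k).continuous)
    (fun k => dense_setOf_forall_ne_intCast
      ((regularForm k).isOpenMap_of_ne_zero (regularForm_ne_zero k)))).mono fun x hx => ?_
  exact regular_ofRealVec fun k => Set.mem_iInter.1 hx k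

lemma entire_eq_zero {f : Entire} {O : Set (Fin 5 → ℝ)} (hO : IsOpen O) (hne : O.Nonempty)
    (h : ∀ x ∈ O, Regular (ofRealVec x) → f.1 (ofRealVec x) = 0) : f = 0 := by
  refine Subtype.ext (eq_zero_of_ofRealVec_of_isOpen f.2 hO hne fun x hx => ?_)
  have hf : Continuous f.1 := continuous_iff_continuousAt.2 fun a =>
    (f.2 a (Set.mem_univ a)).continuousAt
  have hclosed : IsClosed {x | f.1 (ofRealVec x) = 0} :=
    isClosed_eq (hf.comp continuous_ofRealVec) continuous_const
  exact hclosed.closure_subset_iff.2 (fun y hy => h y hy.1 hy.2)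
    (dense_regular.open_subset_closure_inter hO hx)

/-- Evaluation of entire functions at `a`. -/
def evalEntire (a : Fin 5 → ℂ) : Entire →+* ℂ :=
  (Pi.evalRingHom _ a).comp Entire.val.toRingHom

lemma mero_eq_zero {m : Mero} {O : Set (Fin 5 → ℝ)} (hO : IsOpen O) (hne : O.Nonempty)
    (h : ∀ x ∈ O, Regular (ofRealVec x) → HasValue (evalEntire (ofRealVec x)) m 0) : m = 0 := by
  obtain ⟨P, Q, hQ, rfl⟩ := IsFractionRing.div_surjective (A := Entire) m
  suffices P = 0 by rw [this, map_zero, zero_div]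
  refine entire_eq_zero hO hne fun x hx hr => ?_
  have hmul := (h x hx hr).mul (hasValue_algebraMap (K := Mero) Q)
  rw [div_mul_cancel₀ _ (IsFractionRing.to_map_ne_zero_of_mem_nonZeroDivisors hQ),
    zero_mul] at hmul
  exact (hasValue_algebraMap P).unique hmul

lemma hasValue_coordA (a : Fin 5 → ℂ) (i : Fin 5) : HasValue (evalEntire a) (coordA i) (a i) :=
  hasValue_algebraMap (φ := evalEntire a) _

lemma meroShift_algebraMap (f : Entire) :
    meroShift (algebraMap Entire Mero f) = algebraMap Entire Mero (translateEntire f) := by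
  simp only [meroShift, IsFractionRing.map, IsLocalization.map_eq]

lemma meroShift_coordA (i : Fin 5) : meroShift (coordA i) = coordA i + 1 := by
  rw [coordA, meroShift_algebraMap, ← map_one (algebraMap Entire Mero), ← map_add]
  rfl

lemma HasValue.meroShift {a : Fin 5 → ℂ} {m : Mero} {c : ℂ}
    (h : HasValue (evalEntire (shift a 1)) m c) : HasValue (evalEntire a) (meroShift m) c := by
  have heval (f) : evalEntire a (translateEntire f) = evalEntire (shift a 1) f := by
    have hshift : shift a 1 = a + 1 := by
      funext i
      simp [shift]
    rw [hshift]
    rfl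
  obtain ⟨P, Q, hQ, rfl, rfl⟩ := h
  exact ⟨translateEntire P, translateEntire Q, by rwa [heval],
    by rw [map_div₀, meroShift_algebraMap, meroShift_algebraMap], by rw [heval, heval]⟩

/-! ### Rational functions as meromorphic functions -/

lemma eq_zero_of_evalAt {P : MvPolynomial (Fin 5) ℚ} (h : ∀ b, evalAt b P = 0) : P = 0 := by
  apply MvPolynomial.map_injective (algebraMap ℚ ℂ) (algebraMap ℚ ℂ).injective
  rw [map_zero]
  refine MvPolynomial.funext fun b => ?_
  rw [MvPolynomial.eval_map, map_zero]
  exact h b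

/-- Polynomials as entire functions. -/
noncomputable def polyEntire : MvPolynomial (Fin 5) ℚ →+* Entire :=
  MvPolynomial.eval₂Hom ((algebraMap ℂ Entire).comp (algebraMap ℚ ℂ)) fun i =>
    ⟨fun a => a i, (ContinuousLinearMap.proj (R := ℂ) (φ := fun _ : Fin 5 => ℂ) i).analyticOnNhd _⟩

lemma evalEntire_polyEntire (P : MvPolynomial (Fin 5) ℚ) (b : Fin 5 → ℂ) :
    evalEntire b (polyEntire P) = evalAt b P := by
  have h : (evalEntire b).comp polyEntire = evalAt b :=
    MvPolynomial.ringHom_ext (fun r => by simp [polyEntire, evalAt])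
      fun i => by simp [polyEntire, evalAt, evalEntire]
  exact RingHom.congr_fun h P

lemma polyEntire_injective : Function.Injective polyEntire := by
  rw [injective_iff_map_eq_zero]
  exact fun P hP => eq_zero_of_evalAt fun b => by rw [← evalEntire_polyEntire, hP, map_zero]

/-- Rational functions as meromorphic functions. -/
noncomputable def ratMero : RatA →+* Mero :=
  IsFractionRing.map polyEntire_injective

lemma ratMero_algebraMap (P : MvPolynomial (Fin 5) ℚ) :
    ratMero (algebraMap _ RatA P) = algebraMap Entire Mero (polyEntire P) := by
  simp only [ratMero, IsFractionRing.map, IsLocalization.map_eq]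

lemma ratMero_varA : ratMero ∘ varA = coordA := by
  funext i
  rw [Function.comp_apply, varA, ratMero_algebraMap, coordA]
  simp [polyEntire]

lemma bigDelta_map {F E : Type*} [Field F] [Field E] (f : F →+* E) (a : Fin 5 → F)
    (p q : Fin 5 → ℤ) : bigDelta (f ∘ a) p q = f (bigDelta a p q) := by
  simp [bigDelta, Matrix.det_fin_two, rOne, rTwo, connMat_map]

lemma bigDelta_coordA_ne_zero {p q : Fin 5 → ℤ} (hpq : p ≠ q) : bigDelta coordA p q ≠ 0 := by
  rw [← ratMero_varA, bigDelta_map, map_ne_zero]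
  exact bigDelta_varA_ne_zero hpq

lemma coordA_mem_adjoinA (K : Subfield Mero) (i : Fin 5) : coordA i ∈ adjoinA K :=
  Subfield.subset_closure (Or.inr ⟨i, rfl⟩)

lemma connMat_coordA_mem (K : Subfield Mero) (p : Fin 5 → ℤ) (r k : Fin 2) :
    connMat coordA p r k ∈ adjoinA K := by
  have h : coordA = (adjoinA K).subtype ∘ fun i => ⟨coordA i, coordA_mem_adjoinA K i⟩ := rfl
  rw [h, connMat_map]
  exact Subtype.prop _

/-! ### Linear independence -/

section PositivePoints

variable (ν : SingPt) (i : Fin 3)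

/-- The involution `invol ν i` on real points. -/
def involReal (x : Fin 5 → ℝ) : Fin 5 → ℝ := fun j => (invol ν i (ofRealVec x) j).re

lemma ofRealVec_involReal (x : Fin 5 → ℝ) :
    ofRealVec (involReal ν i x) = invol ν i (ofRealVec x) := by
  funext j
  refine Complex.ext rfl ?_
  cases ν <;> fin_cases i <;> fin_cases j <;> simp [invol, ofRealVec]

lemma involReal_involReal (x : Fin 5 → ℝ) : involReal ν i (involReal ν i x) = x := by
  funext j
  rw [involReal, ofRealVec_involReal, invol_invol, ofRealVec, Complex.ofReal_re]

lemma continuous_involReal : Continuous (involReal ν i) := by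
  refine continuous_pi fun j => ?_
  cases ν <;> fin_cases i <;> fin_cases j <;> simp [involReal, invol, ofRealVec] <;> fun_prop

/-- The real points at which the series of a companion has positive terms. -/
def posSet (N : ℝ) : Set (Fin 5 → ℝ) :=
  {x | (∀ j, 0 < involReal ν i x j) ∧ N < saal x}

lemma isOpen_posSet (N : ℝ) : IsOpen (posSet ν i N) := by
  have hsaal : Continuous fun x : Fin 5 → ℝ => saal x := by
    simp only [saal]
    fun_prop
  have hpos : IsOpen {x | ∀ j, 0 < involReal ν i x j} := by
    rw [Set.ofPred_forall]
    exact isOpen_iInter_of_finite fun j =>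
      isOpen_lt continuous_const ((continuous_apply j).comp (continuous_involReal ν i))
  exact hpos.inter (isOpen_lt continuous_const hsaal)

lemma saal_ofRealVec (x : Fin 5 → ℝ) : saal (ofRealVec x) = saal x :=
  saal_map Complex.ofRealHom x

lemma saal_involReal (x : Fin 5 → ℝ) : saal (involReal ν i x) = saal x := by
  rw [← Complex.ofReal_inj, ← saal_ofRealVec, ofRealVec_involReal, saal_invol, saal_ofRealVec]

lemma posSet_nonempty (N : ℝ) : (posSet ν i N).Nonempty := by
  refine ⟨involReal ν i ![1, 1, 1, |N| + 3, 1], fun j => ?_, ?_⟩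
  · rw [involReal_involReal]
    fin_cases j <;> simp; positivity
  · rw [saal_involReal]
    simp [saal]
    linarith [le_abs_self N]

variable {ν i}

lemma companion_ne_zero {N : ℝ} (hN : 0 ≤ N) {x : Fin 5 → ℝ} (hx : x ∈ posSet ν i N)
    (hr : Regular (ofRealVec x)) : companion ν i (ofRealVec x) ≠ 0 := by
  have hgen : Generic (ofRealVec (involReal ν i x)) :=
    (ofRealVec_involReal ν i x).symm ▸ hr.1.invol ν i
  have hs : 0 < (saal (ofRealVec (involReal ν i x))).re := by
    rw [saal_ofRealVec, saal_involReal]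
    exact hN.trans_lt hx.2
  rw [companion_eq, ← ofRealVec_involReal]
  exact mul_ne_zero (compFactor_ne_zero _ _) (hgf_ofReal_ne_zero hgen hs hx.1)

end PositivePoints

section Relation

variable {ν : SingPt} {i : Fin 3} {p q : Fin 5 → ℤ} {N : ℝ}

lemma riccati_of_orthogonal {R : Type*} [CommRing R] [IsDomain R]
    {h h' h'' u v u' v' s ψ φ : R} (hh : h ≠ 0) (hrec : s * h'' = φ * h + ψ * h')
    (huv : u * h + v * h' = 0) (huv' : u' * h' + v' * h'' = 0) :
    u * (s * u' + ψ * v') = φ * v * v' := by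
  refine mul_right_cancel₀ hh ?_
  linear_combination (s * u' + ψ * v') * huv - v * s * huv' + v * v' * hrec

lemma isRiccati_of_values {U V : Mero} {u v : (Fin 5 → ℂ) → ℂ}
    (hU : ∀ b, Regular b → HasValue (evalEntire b) U (u b))
    (hV : ∀ b, Regular b → HasValue (evalEntire b) V (v b))
    (hrel : ∀ b, Regular b → N < (saal b).re →
      u b * companion ν i b + v b * companion ν i (shift b 1) = 0) :
    IsRiccati meroShift coordA U V := by
  rw [IsRiccati, ← sub_eq_zero]
  refine mero_eq_zero (isOpen_posSet ν i (|N| + 2)) (posSet_nonempty ν i _) fun x hx hr => ?_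
  have hne := companion_ne_zero (by positivity) hx hr
  have hs : |N| + 2 < (saal (ofRealVec x)).re := by
    rw [saal_ofRealVec]
    exact hx.2
  have hN := le_abs_self N
  have hN0 := abs_nonneg N
  have hrel_one := hrel _ (hr.shift 1) (by rw [re_saal_shift_one]; linarith)
  rw [shift_one_shift_one] at hrel_one
  have hric := riccati_of_orthogonal hne
    ((isContiguous_companion ν i).recurrence hr.1 (by linarith)) (hrel _ hr (by linarith)) hrel_one
  have hc := hasValue_coordA (ofRealVec x)
  have hU' := (hU _ (hr.shift 1)).meroShift
  have hV' := (hV _ (hr.shift 1)).meroShift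
  rw [← sub_eq_zero.2 hric]
  exact ((hU _ hr).mul ((((hasValue_saal hc).sub hasValue_two).mul hU').add
    ((hasValue_psi hc).mul hV'))).sub (((hasValue_phiThree hc).mul (hV _ hr)).mul hV')

lemma IsContiguous.apply_shift {h : (Fin 5 → ℂ) → ℂ} (hh : IsContiguous h) {b : Fin 5 → ℂ}
    (hb : Regular b) (hs : 1 < (saal b).re) (hp : 1 < (saal (shift b p)).re) :
    h (shift b p) = rOne b p * h b + rTwo b p * h (shift b 1) := by
  obtain ⟨w, rfl, hw⟩ := exists_goodPath hs hp
  have hpair := (pairVec_endPt hh (hasValue_varA b) hb.1 hs hw).1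
  rw [pathMat_eq_connMat hb rfl] at hpair
  simpa [pairVec, Matrix.mulVec, dotProduct, Fin.sum_univ_two, rOne, rTwo] using congrFun hpair 0

lemma isRiccati_of_relation {X Y : Entire} (hrel : ∀ a, Regular a → N < (saal a).re →
      X.1 a * companion ν i (shift a p) + Y.1 a * companion ν i (shift a q) = 0) :
    IsRiccati meroShift coordA
      (algebraMap Entire Mero X * rOne coordA p + algebraMap Entire Mero Y * rOne coordA q)
      (algebraMap Entire Mero X * rTwo coordA p + algebraMap Entire Mero Y * rTwo coordA q) := by
  have hval (b) (hb : Regular b) (k : Fin 2) : HasValue (evalEntire b)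
      (algebraMap Entire Mero X * connMat coordA p 0 k +
        algebraMap Entire Mero Y * connMat coordA q 0 k)
      (X.1 b * connMat b p 0 k + Y.1 b * connMat b q 0 k) :=
    ((hasValue_algebraMap X).mul (hasValue_pathMat _ (hasValue_coordA b) hb 0 k)).add
      ((hasValue_algebraMap Y).mul (hasValue_pathMat _ (hasValue_coordA b) hb 0 k))
  refine isRiccati_of_values (ν := ν) (i := i)
    (N := |N| + |((saal p : ℤ) : ℝ)| + |((saal q : ℤ) : ℝ)| + 1)
    (fun b hb => hval b hb 0) (fun b hb => hval b hb 1) fun b hb hs => ?_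
  have hN := abs_nonneg N
  have hp := abs_nonneg ((saal p : ℤ) : ℝ)
  have hq := abs_nonneg ((saal q : ℤ) : ℝ)
  have hN' := le_abs_self N
  have hp' := neg_abs_le ((saal p : ℤ) : ℝ)
  have hq' := neg_abs_le ((saal q : ℤ) : ℝ)
  have hh := isContiguous_companion ν i
  have hb_rel := hrel b hb (by linarith)
  rw [hh.apply_shift (p := p) hb (by linarith) (by rw [re_saal_shift]; linarith),
    hh.apply_shift (p := q) hb (by linarith) (by rw [re_saal_shift]; linarith)] at hb_rel
  simp only [rOne, rTwo] at hb_rel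
  linear_combination hb_rel

lemma eq_zero_of_bigDelta_ne_zero {F : Type*} [Field F] {a : Fin 5 → F}
    (hΔ : bigDelta a p q ≠ 0) {x y : F} (h₁ : x * rOne a p + y * rOne a q = 0)
    (h₂ : x * rTwo a p + y * rTwo a q = 0) : x = 0 ∧ y = 0 := by
  rw [bigDelta, Matrix.det_fin_two_of] at hΔ
  constructor
  · refine (mul_eq_zero.1 ?_).resolve_right hΔ
    linear_combination rTwo a q * h₁ - rOne a q * h₂
  · refine (mul_eq_zero.1 ?_).resolve_right hΔ
    linear_combination rOne a p * h₂ - rTwo a p * h₁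

lemma eq_zero_of_relation {K : Subfield Mero} (hK : ∀ f ∈ K, meroShift f ∈ K)
    (hal : AlgebraicIndependent K coordA) (hpq : p ≠ q) {X Y Z : Entire} (hZ : Z ≠ 0)
    (hx : algebraMap Entire Mero X / algebraMap Entire Mero Z ∈ adjoinA K)
    (hy : algebraMap Entire Mero Y / algebraMap Entire Mero Z ∈ adjoinA K)
    (hrel : ∀ a, Regular a → N < (saal a).re →
      X.1 a * companion ν i (shift a p) + Y.1 a * companion ν i (shift a q) = 0) :
    algebraMap Entire Mero X / algebraMap Entire Mero Z = 0 ∧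
      algebraMap Entire Mero Y / algebraMap Entire Mero Z = 0 := by
  have hZ' : algebraMap Entire Mero Z ≠ 0 := by rwa [Ne, IsFractionRing.to_map_eq_zero_iff]
  have hric := isRiccati_of_relation hrel
  rw [← mul_div_cancel₀ (algebraMap Entire Mero X) hZ',
    ← mul_div_cancel₀ (algebraMap Entire Mero Y) hZ'] at hric
  simp only [mul_assoc, ← mul_add] at hric
  have hmem (k : Fin 2) := add_mem (mul_mem hx (connMat_coordA_mem K p 0 k))
    (mul_mem hy (connMat_coordA_mem K q 0 k))
  obtain ⟨h₁, h₂⟩ :=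
    (hric.of_mul_left hZ').eq_zero_of_mem_closure hK meroShift_coordA hal (hmem 0) (hmem 1)
  exact eq_zero_of_bigDelta_ne_zero (bigDelta_coordA_ne_zero hpq) h₁ h₂

lemma mem_convSet_of_abs_lt {a : Fin 5 → ℂ} (ha : Generic a)
    (h : |((saal p : ℤ) : ℝ)| < (saal a).re) : a ∈ convSet p := by
  refine ⟨ha, ?_⟩
  rw [re_saal_shift]
  linarith [neg_abs_le ((saal p : ℤ) : ℝ)]

lemma linIndepOver_companion {K : Subfield Mero} (hK : ∀ f ∈ K, meroShift f ∈ K)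
    (hal : AlgebraicIndependent K coordA) (ν : SingPt) (i : Fin 3) (hpq : p ≠ q) :
    LinIndepOver (adjoinA K) (convSet p ∩ convSet q)
      (fun a => companion ν i (shift a p)) (fun a => companion ν i (shift a q)) := by
  rintro x hx y hy ⟨X, Y, Z, hZ, rfl, rfl, hrel⟩
  refine eq_zero_of_relation (N := max |((saal p : ℤ) : ℝ)| |((saal q : ℤ) : ℝ)|) hK hal hpq
    hZ hx hy fun a ha hs => hrel a ⟨?_, ?_⟩
  · exact mem_convSet_of_abs_lt ha.1 ((le_max_left _ _).trans_lt hs)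
  · exact mem_convSet_of_abs_lt ha.1 ((le_max_right _ _).trans_lt hs)

end Relation

/-! ### The three-term relation -/

lemma RegularAt.hasValue {u : RatA} {a : Fin 5 → ℂ} (h : RegularAt u a) :
    HasValue (evalAt a) u (valueAt u a) :=
  ⟨_, _, h, (IsFractionRing.mk'_num_den' (MvPolynomial (Fin 5) ℚ) u).symm, rfl⟩

lemma connMat_row_one_combination {F : Type*} [Field F] {x : Fin 5 → F} (hx : Regular x)
    {p q : Fin 5 → ℤ} {u v : F} (h₁ : u * rOne (shift x 1) p + v * rOne (shift x 1) q = 1)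
    (h₂ : u * rTwo (shift x 1) p + v * rTwo (shift x 1) q = 0) :
    u * connMat x p 1 0 + v * connMat x q 1 0 = 0 ∧
      u * connMat x p 1 1 + v * connMat x q 1 1 = 1 := by
  rw [rOne, rOne] at h₁
  rw [rTwo, rTwo] at h₂
  simp only [connMat_row_one hx, Matrix.vecMul, dotProduct, Fin.sum_univ_two, oneMat,
    Matrix.of_apply, Matrix.cons_val', Matrix.cons_val_zero, Matrix.cons_val_one,
    Matrix.cons_val_fin_one]
  constructor
  · linear_combination phiThree x / (saal x - 2) * h₂
  · linear_combination psi x / (saal x - 2) * h₂ + h₁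

lemma shift_shift_neg_one_shift_one {F : Type*} [Field F] (a : Fin 5 → F) (p : Fin 5 → ℤ) :
    shift (shift (shift a (-1)) p) 1 = shift a p := by
  rw [shift_shift, shift_shift, neg_add_eq_sub, add_sub_cancel_right]

lemma shift_neg_one_shift_one {F : Type*} [Field F] (a : Fin 5 → F) :
    shift (shift a (-1)) 1 = a := by
  rw [shift_shift, neg_add_cancel, shift_zero]

/- The pair `(h(a), h(a + 𝟏))` is available only where `Re s(a) > 1`, while the relation is claimed
for `Re s(a) > 0`. Hence it is read off the second components of the pairs at `a - 𝟏`. -/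
lemma threeTermRel_of_rows {h : (Fin 5 → ℂ) → ℂ} (hh : IsContiguous h) {p q : Fin 5 → ℤ}
    {u v : RatA} (h₁ : u * rOne varA p + v * rOne varA q = 1)
    (h₂ : u * rTwo varA p + v * rTwo varA q = 0) : ThreeTermRel h p q u v := by
  rintro a ⟨⟨ha, hap⟩, haq⟩ hu hv
  have hgen := ha.1.shift (-1)
  have hxr := regular_varA.shift (-1)
  have hxv := hasValue_shift (hasValue_varA a) (-1)
  have hs (r : Fin 5 → ℤ) (hr : a ∈ convSet r) : 1 < (saal (shift (shift a (-1)) r)).re := by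
    have hpos := hr.2
    rw [← shift_shift_neg_one_shift_one, re_saal_shift_one] at hpos
    linarith
  have hs₀ : 1 < (saal (shift a (-1))).re := by simpa only [shift_zero] using hs 0 ha
  obtain ⟨M, hM, hMval⟩ := exists_pairVec_shift hh hxv hxr hgen hs₀ (hs p hap)
  obtain ⟨M', hM', hMval'⟩ := exists_pairVec_shift hh hxv hxr hgen hs₀ (hs q haq)
  have hrow (k : Fin 2) := (hu.hasValue.mul (hMval 1 k)).add (hv.hasValue.mul (hMval' 1 k))
  rw [← shift_neg_one_shift_one varA] at h₁ h₂
  obtain ⟨h₀, h₁⟩ := connMat_row_one_combination hxr h₁ h₂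
  have hc₀ := (h₀ ▸ hrow 0).unique hasValue_zero
  have hc₁ := (h₁ ▸ hrow 1).unique hasValue_one
  have hp := congrFun hM 1
  have hq := congrFun hM' 1
  simp only [pairVec, shift_shift_neg_one_shift_one, shift_neg_one_shift_one, Matrix.mulVec,
    dotProduct, Fin.sum_univ_two, Matrix.cons_val_zero, Matrix.cons_val_one] at hp hq
  rw [hp, hq]
  linear_combination -h (shift a (-1)) * hc₀ - h a * hc₁

/-- The rational constants as meromorphic functions. -/
noncomputable def ratConst : ℚ →+* Mero :=
  ratMero.comp ((algebraMap (MvPolynomial (Fin 5) ℚ) RatA).comp MvPolynomial.C)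

lemma meroShift_mem_ratConst : ∀ f ∈ ratConst.fieldRange, meroShift f ∈ ratConst.fieldRange := by
  rintro _ ⟨r, rfl⟩
  exact ⟨r, RingHom.congr_fun (RingHom.ext_rat ratConst (meroShift.comp ratConst)) r⟩

lemma aeval_coordA_comp_map : (MvPolynomial.aeval (R := ratConst.fieldRange) coordA :
      MvPolynomial (Fin 5) ratConst.fieldRange →+* Mero).comp
      (MvPolynomial.map ratConst.rangeRestrictField) =
    ratMero.comp (algebraMap (MvPolynomial (Fin 5) ℚ) RatA) := by
  refine MvPolynomial.ringHom_ext (fun r => ?_) fun i => ?_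
  · simp only [RingHom.comp_apply, RingHom.coe_coe, MvPolynomial.map_C, MvPolynomial.aeval_C]
    rfl
  · simp only [RingHom.comp_apply, RingHom.coe_coe, MvPolynomial.map_X, MvPolynomial.aeval_X]
    exact (congrFun ratMero_varA i).symm

lemma algebraicIndependent_ratConst : AlgebraicIndependent ratConst.fieldRange coordA := by
  rw [algebraicIndependent_iff_injective_aeval, injective_iff_map_eq_zero]
  intro P hP
  obtain ⟨P, rfl⟩ := MvPolynomial.map_surjective _ ratConst.rangeRestrictField_bijective.2 P
  have h : ratMero (algebraMap (MvPolynomial (Fin 5) ℚ) RatA P) = 0 :=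
    (RingHom.congr_fun aeval_coordA_comp_map P).symm.trans hP
  rw [map_eq_zero, IsFractionRing.to_map_eq_zero_iff] at h
  rw [h, map_zero]

lemma polyEntire_mem_adjoinA (P : MvPolynomial (Fin 5) ℚ) :
    algebraMap Entire Mero (polyEntire P) ∈ adjoinA ratConst.fieldRange := by
  rw [← ratMero_algebraMap]
  induction P using MvPolynomial.induction_on with
  | C r => exact Subfield.subset_closure (Or.inl ⟨r, rfl⟩)
  | add P Q hP hQ => rw [map_add, map_add]; exact add_mem hP hQ
  | mul_X P i hP =>
    rw [map_mul, map_mul]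
    exact mul_mem hP (Subfield.subset_closure (Or.inr ⟨i, (congrFun ratMero_varA i).symm⟩))

section Denominators

variable {w : RatA} {D : MvPolynomial (Fin 5) ℚ}
  (h : (IsFractionRing.den (MvPolynomial (Fin 5) ℚ) w : MvPolynomial (Fin 5) ℚ) ∣ D)
include h

lemma regularAt_of_den_dvd {a : Fin 5 → ℂ} (ha : evalAt a D ≠ 0) : RegularAt w a := by
  obtain ⟨E, rfl⟩ := h
  rw [map_mul] at ha
  exact left_ne_zero_of_mul ha

/- The square makes both sides vanish at the zeros of `D`, where `valueAt w a` may be the junk value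
of a division by zero. -/
lemma exists_numerator : ∃ n : MvPolynomial (Fin 5) ℚ,
    algebraMap _ RatA n = w * algebraMap _ RatA (D ^ 2) ∧
      ∀ a, evalAt a n = valueAt w a * evalAt a (D ^ 2) := by
  obtain ⟨E, rfl⟩ := h
  set d := (IsFractionRing.den (MvPolynomial (Fin 5) ℚ) w : MvPolynomial (Fin 5) ℚ)
  have hd : algebraMap (MvPolynomial (Fin 5) ℚ) RatA d ≠ 0 :=
    IsFractionRing.to_map_ne_zero_of_mem_nonZeroDivisors (Subtype.prop _)
  have hw : w * algebraMap _ RatA d = algebraMap _ RatA (IsFractionRing.num _ w) :=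
    ((div_eq_iff hd).1 (IsFractionRing.mk'_num_den' (MvPolynomial (Fin 5) ℚ) w)).symm
  refine ⟨IsFractionRing.num _ w * d * E ^ 2, ?_, fun a => ?_⟩
  · simp only [map_mul, map_pow, ← hw]
    ring
  · have ha : evalAt a (IsFractionRing.num _ w) * evalAt a d = valueAt w a * evalAt a d ^ 2 := by
      rcases eq_or_ne (evalAt a d) 0 with h0 | h0
      · rw [h0, zero_pow two_ne_zero, mul_zero, mul_zero]
      · rw [sq, ← mul_assoc]
        exact congrArg (· * _) (div_mul_cancel₀ _ h0).symm
    rw [map_mul, map_mul, ha]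
    simp only [map_mul, map_pow]
    ring

end Denominators

lemma exists_common_den {ι : Type*} [Fintype ι] (w : ι → RatA) :
    ∃ D : MvPolynomial (Fin 5) ℚ, D ≠ 0 ∧
      ∀ k, (IsFractionRing.den (MvPolynomial (Fin 5) ℚ) (w k) : MvPolynomial (Fin 5) ℚ) ∣ D :=
  ⟨∏ k, (IsFractionRing.den (MvPolynomial (Fin 5) ℚ) (w k)).1,
    Finset.prod_ne_zero_iff.2 fun _ _ => nonZeroDivisors.coe_ne_zero _,
    fun k => Finset.dvd_prod_of_mem _ (Finset.mem_univ k)⟩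

section Uniqueness

variable {ν : SingPt} {i : Fin 3} {p q : Fin 5 → ℤ}

lemma eq_zero_of_polynomial_relation (hpq : p ≠ q) {P Q : MvPolynomial (Fin 5) ℚ} {N : ℝ}
    (hrel : ∀ a, Regular a → N < (saal a).re →
      evalAt a P * companion ν i (shift a p) + evalAt a Q * companion ν i (shift a q) = 0) :
    P = 0 ∧ Q = 0 := by
  have hmem (P : MvPolynomial (Fin 5) ℚ) :
      algebraMap Entire Mero (polyEntire P) / algebraMap Entire Mero 1 ∈
        adjoinA ratConst.fieldRange := by
    rw [map_one, div_one]
    exact polyEntire_mem_adjoinA P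
  obtain ⟨hP, hQ⟩ := eq_zero_of_relation meroShift_mem_ratConst algebraicIndependent_ratConst hpq
    one_ne_zero (hmem P) (hmem Q) fun a ha hs => by
      rw [← hrel a ha hs, ← evalEntire_polyEntire, ← evalEntire_polyEntire]
      rfl
  rw [map_one, div_one, IsFractionRing.to_map_eq_zero_iff,
    map_eq_zero_iff _ polyEntire_injective] at hP hQ
  exact ⟨hP, hQ⟩

lemma threeTermRel_unique (hpq : p ≠ q) {u v u' v' : RatA}
    (h : ThreeTermRel (companion ν i) p q u v) (h' : ThreeTermRel (companion ν i) p q u' v') :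
    u' = u ∧ v' = v := by
  obtain ⟨D, hD₀, hden⟩ := exists_common_den ![u, v, u', v']
  obtain ⟨n, hn, hna⟩ := exists_numerator (w := u) (hden 0)
  obtain ⟨m, hm, hma⟩ := exists_numerator (w := v) (hden 1)
  obtain ⟨n', hn', hna'⟩ := exists_numerator (w := u') (hden 2)
  obtain ⟨m', hm', hma'⟩ := exists_numerator (w := v') (hden 3)
  obtain ⟨hX, hY⟩ := eq_zero_of_polynomial_relation (ν := ν) (i := i) hpq (P := n' - n)
    (Q := m' - m) (N := max |((saal p : ℤ) : ℝ)| |((saal q : ℤ) : ℝ)|) fun a ha hs => by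
    simp only [map_sub, hna, hma, hna', hma']
    obtain ⟨hp, hq⟩ := max_lt_iff.1 hs
    rcases eq_or_ne (evalAt a D) 0 with hDa | hDa
    · simp [hDa]
    · have hmem : a ∈ convSet 0 ∩ convSet p ∩ convSet q :=
        ⟨⟨mem_convSet_of_abs_lt ha.1 (by simpa [saal] using (abs_nonneg _).trans_lt hp),
          mem_convSet_of_abs_lt ha.1 hp⟩, mem_convSet_of_abs_lt ha.1 hq⟩
      linear_combination evalAt a (D ^ 2) *
        (h a hmem (regularAt_of_den_dvd (hden 0) hDa) (regularAt_of_den_dvd (hden 1) hDa) -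
          h' a hmem (regularAt_of_den_dvd (hden 2) hDa) (regularAt_of_den_dvd (hden 3) hDa))
  have hD : algebraMap _ RatA (D ^ 2) ≠ 0 := by
    rw [Ne, IsFractionRing.to_map_eq_zero_iff]
    exact pow_ne_zero 2 hD₀
  exact ⟨mul_right_cancel₀ hD (by rw [← hn, ← hn', sub_eq_zero.1 hX]),
    mul_right_cancel₀ hD (by rw [← hm, ← hm', sub_eq_zero.1 hY])⟩

end Uniqueness

end HypThreeTerm

theorem proposition5p1 (p q : Fin 5 → ℤ) (hpq : p ≠ q) :
    -- the determinant
    (bigDelta varA p q = smallDelta varA p * rTwo (shift varA p) (q - p) ∧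
      bigDelta varA p q ≠ 0) ∧
    -- linear independence over `K(a)`
    (∀ K : Subfield Mero, (∀ f ∈ K, meroShift f ∈ K) → AlgebraicIndependent K coordA →
      ∀ (ν : SingPt) (i : Fin 3),
        LinIndepOver (adjoinA K) (convSet p ∩ convSet q)
          (fun a => companion ν i (shift a p)) (fun a => companion ν i (shift a q))) ∧
    -- the three-term relation, common to the six companions, and its uniqueness for each of them
    (∃ u v : RatA,
      u = rTwo varA q / bigDelta varA p q ∧
      u = rTwo varA q / (smallDelta varA p * rTwo (shift varA p) (q - p)) ∧
      v = -(rTwo varA p / bigDelta varA p q) ∧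
      v = -(rTwo varA p / (smallDelta varA p * rTwo (shift varA p) (q - p))) ∧
      ∀ (ν : SingPt) (i : Fin 3),
        ThreeTermRel (companion ν i) p q u v ∧
        ∀ u' v' : RatA, ThreeTermRel (companion ν i) p q u' v' → u' = u ∧ v' = v) := by
  have hΔ := bigDelta_eq regular_varA p q
  have hΔ₀ := bigDelta_varA_ne_zero hpq
  have hdet : bigDelta varA p q = rOne varA p * rTwo varA q - rTwo varA p * rOne varA q :=
    Matrix.det_fin_two_of _ _ _ _
  refine ⟨⟨hΔ, hΔ₀⟩, fun K hK hal ν i => linIndepOver_companion hK hal ν i hpq,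
    _, _, rfl, by rw [hΔ], rfl, by rw [hΔ], fun ν i => ?_⟩
  have hrel : ThreeTermRel (companion ν i) p q (rTwo varA q / bigDelta varA p q)
      (-(rTwo varA p / bigDelta varA p q)) := by
    refine threeTermRel_of_rows (isContiguous_companion ν i) ?_ ?_ <;> field_simp
    · rw [hdet]
      ring
    · ring
  exact ⟨hrel, fun u' v' h' => threeTermRel_unique hpq hrel h'⟩
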